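/- There are absolute constants $b, s, c, r$ and a deterministic algorithm in the congested clique model that achieves the following for all integers $n \ge 1$ and $k \ge 1$ (both known to all nodes). The nodes are the $n$ vertices of an arbitrary undirected unweighted simple graph $G$, identified by $0,\dots,n-1$; initially every node knows its own identifier and the set of its neighbours in $G$. In every synchronous round each node may send a (possibly different) message of $b\lceil \log_2 n\rceil = O(\log n)$ bits to each of the nodes, and local computation is not restricted. After at most $r \log k = O(\log k)$ rounds the algorithm stops with a subgraph $H \subseteq G$ (every node knows the edges of $H$ incident to it) such that 1. $H$ is an $O(k)$-spanner of $G$: $\mathrm{dist}_H(u,v) \le s\,k\cdot \mathrm{dist}_G(u,v)$ for all vertices $u,v$ of $G$ (with distance $\infty$ between different components), and 2. $H$ has at most $c\,k\,n^{1+1/k} = O(k\cdot n^{1+1/k})$ edges. -/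

import Mathlib

namespace CongestedClique

/-- A message of `B` bits. -/
abbrev Message (B : ℕ) : Type := Fin B → Bool

/-- A deterministic algorithm for the congested clique on the nodes `0, …, n - 1`, with
messages of `B` bits. As usual in this model the local computation of a node is unrestricted;
what is counted is the number of synchronous communication rounds. -/
structure Algorithm (n B : ℕ) where
  /-- The local states of a node. -/
  State : Type
  /-- The initial state of a node, from its identifier and the set of its neighbours. -/
  init : Fin n → Set (Fin n) → State
  /-- `send u σ v` is the message that node `u` in state `σ` sends to node `v`. -/
  send : Fin n → State → Fin n → Message B
  /-- `step v σ m` is the next state of node `v` in state `σ` when it receives the message `m u`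
  from every node `u`. -/
  step : Fin n → State → (Fin n → Message B) → State
  /-- The number of rounds after which all nodes stop. -/
  rounds : ℕ
  /-- The output of a node in its last state: a set of nodes, those joined to it in the
  constructed graph. -/
  result : Fin n → State → Set (Fin n)

namespace Algorithm

variable {n B : ℕ}

/-- The state of every node after a given number of rounds, on the input graph `G`. In every
round each node may send a different message to each node, whether or not they are adjacent
in `G`. -/
def stateAfter (A : Algorithm n B) (G : SimpleGraph (Fin n)) : ℕ → Fin n → A.State
  | 0, v => A.init v (G.neighborSet v)
  | t + 1, v => A.step v (A.stateAfter G t v) fun u => A.send u (A.stateAfter G t u) v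

/-- The output of node `v` on the input graph `G`. -/
def output (A : Algorithm n B) (G : SimpleGraph (Fin n)) (v : Fin n) : Set (Fin n) :=
  A.result v (A.stateAfter G A.rounds v)

/-- On the input graph `G` the algorithm constructs the graph `H`: when it stops, every node
knows which edges of `H` it is incident to. -/
def Constructs (A : Algorithm n B) (G H : SimpleGraph (Fin n)) : Prop :=
  ∀ v, A.output G v = H.neighborSet v

end Algorithm

end CongestedClique

/-- `H` is a `t`-spanner of the unweighted graph `G`: a subgraph that preserves all distances up
to the factor `t`. The distances are extended: `⊤` between different components. -/
def SimpleGraph.IsSpanner {V : Type*} (G H : SimpleGraph V) (t : ℕ) : Prop :=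
  H ≤ G ∧ ∀ u v : V, H.edist u v ≤ (t : ℕ∞) * G.edist u v

/-!
Every vertex should choose few edges so that the chosen edges form an `O(k)`-spanner. The
deterministic local construction of Derbel, Gavoille, Peleg and Viennot (`SimpleGraph.picked`) does
this in `k` steps of local communication: each active vertex has a region around it and picks up to
`σ = O(n ^ (1 / k))` active neighbours with disjoint regions; either all its other active neighbours
then have regions that meet a picked one, so that the edges to them are spanned, or its new region
is larger than the old ones by a factor of `σ`, which can happen fewer than `k` times. The choices
of a vertex depend on its ball of radius `k` only (`SimpleGraph.picked_congr`), and so no further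
communication is needed once it knows this ball.

Balls are collected by doubling their radius `O(log k)` times. A vertex whose ball is small sends
the ball to all the vertices in it. Since "`u` is in the ball of `v`" is a symmetric relation, each
vertex also receives from few others, and if small means at most a small power of `n` then the
messages can be routed in three rounds (`Known.multicast`). A vertex `v` whose ball becomes too
large stops. So does one that finds a stopped vertex in its ball: it adds a path to this vertex to
the spanner, and thus it is joined by a path of length `O(k)` to a root, whose ball is large.

The roots are grouped into clusters by a hitting set for their large balls. To find one
deterministically, the nodes examine `n` candidates in parallel, one per node, from an almost
pairwise independent family of hash functions; Chebyshev's inequality shows that one of them is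
small and misses few balls (`exists_hitting_family`). The balls that are missed become clusters
with their own root as the centre. This leaves `O(n / y ^ 2)` clusters of radius `O(k)`, where `y`
is about `n ^ (1 / 26)`, and at most `O(k n)` path edges.

It remains to span the edges between clusters. A cluster with fewer than `y ^ 2` adjacent clusters
keeps one edge to each of them and is dissolved. The others are merged into adjacent clusters chosen
by a hitting set, which reduces the number of the clusters by a factor of `y / 15` and at most
quadruples their radius (`exists_merge`). After a constant number of such steps, `O(√n)` clusters
of radius `O(k)` remain, and one edge between any two adjacent ones is affordable.

For `k = 1`, where no round is available, and for small `n` the graph is its own spanner.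
-/

/-! ### What the nodes can compute in a given number of rounds -/

namespace CongestedClique

variable {n B : ℕ}

/-- All that a node has seen: its neighbourhood and the messages received in each round, the most
recent round first. -/
abbrev History (n B : ℕ) : Type := Set (Fin n) × List (Fin n → Message B)

/-- The algorithm in which every node remembers its whole history and derives its messages
from it. -/
def historyAlgorithm (S : Fin n → History n B → Fin n → Message B) (r : ℕ)
    (res : Fin n → History n B → Set (Fin n)) : Algorithm n B where
  State := History n B
  init _ N := (N, [])
  send := S
  step _ h m := (h.1, m :: h.2)
  rounds := r
  result := res

/-- The history of node `v` on the input `G` after `t` rounds. -/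
def historyAfter (S : Fin n → History n B → Fin n → Message B) (G : SimpleGraph (Fin n)) :
    ℕ → Fin n → History n B
  | 0, v => (G.neighborSet v, [])
  | t + 1, v => ((historyAfter S G t v).1,
      (fun u => S u (historyAfter S G t u) v) :: (historyAfter S G t v).2)

theorem historyAlgorithm_stateAfter (S : Fin n → History n B → Fin n → Message B) (r : ℕ)
    (res : Fin n → History n B → Set (Fin n)) (G : SimpleGraph (Fin n)) (t : ℕ) (v : Fin n) :
    (historyAlgorithm S r res).stateAfter G t v = historyAfter S G t v := by
  induction t generalizing v with
  | zero => rfl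
  | succ t ih =>
    simp only [Algorithm.stateAfter, ih, historyAfter]
    rfl

theorem length_historyAfter (S : Fin n → History n B → Fin n → Message B)
    (G : SimpleGraph (Fin n)) (t : ℕ) (v : Fin n) :
    (historyAfter S G t v).2.length = t := by
  induction t generalizing v with
  | zero => rfl
  | succ t ih => simp [historyAfter, ih]

theorem historyAfter_congr {S S' : Fin n → History n B → Fin n → Message B} {r : ℕ}
    (h : ∀ u x v, x.2.length < r → S u x v = S' u x v) (G : SimpleGraph (Fin n)) (t : ℕ)
    (ht : t ≤ r) (v : Fin n) : historyAfter S G t v = historyAfter S' G t v := by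
  induction t generalizing v with
  | zero => rfl
  | succ t ih =>
    have ih' := fun v => ih (by omega) v
    simp only [historyAfter, ih']
    refine Prod.ext rfl ?_
    simp only [List.cons.injEq, and_true]
    funext u
    exact h _ _ _ (by rw [length_historyAfter]; omega)

/-- `Known B r f`: some protocol with messages of `B` bits lets every node `v`, on every input
graph `G`, compute `f G v` after `r` rounds. -/
def Known (B : ℕ) {n : ℕ} {σ : Type} (r : ℕ) (f : SimpleGraph (Fin n) → Fin n → σ) : Prop :=
  ∃ (S : Fin n → History n B → Fin n → Message B) (dec : Fin n → History n B → σ),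
    ∀ G v, dec v (historyAfter S G r v) = f G v

/-- Values of type `M` can be sent in one message of `B` bits. -/
def Fits (B : ℕ) (M : Type) : Prop := Nonempty M ∧ Nonempty (M ↪ Message B)

theorem Fits.of_card {M : Type} [Fintype M] [Nonempty M] {b : ℕ}
    (h : Fintype.card M ≤ n ^ b) : Fits (b * Nat.clog 2 n) M := by
  refine ⟨inferInstance, ?_⟩
  rw [Function.Embedding.nonempty_iff_card_le]
  refine h.trans ?_
  rw [Fintype.card_fun, Fintype.card_bool, Fintype.card_fin, mul_comm, pow_mul]
  exact Nat.pow_le_pow_left (Nat.le_pow_clog (by norm_num) n) b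

theorem fits_fin (hn : 2 ≤ n) {m : ℕ} (h0 : 0 < m) (hm : m ≤ 2 * n + 1) :
    Fits (5 * Nat.clog 2 n) (Fin m) := by
  have : Nonempty (Fin m) := ⟨⟨0, h0⟩⟩
  refine Fits.of_card ?_
  rw [Fintype.card_fin]
  calc m ≤ 2 * n + 1 := hm
    _ ≤ n ^ 2 + 2 ^ 2 * n ^ 1 := by nlinarith
    _ ≤ n ^ 2 + n ^ 2 * n ^ 1 := by gcongr
    _ ≤ n ^ 5 := by
      have h2 := Nat.pow_le_pow_left hn 2
      have h3 := Nat.pow_le_pow_left hn 3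
      have : n ^ 5 = n ^ 2 * n ^ 3 := by ring
      have : n ^ 2 * n ^ 1 = n ^ 3 := by ring
      nlinarith

theorem fits_bool (hn : 2 ≤ n) : Fits (5 * Nat.clog 2 n) (Bool × Bool) := by
  refine Fits.of_card ?_
  have := Nat.pow_le_pow_left hn 5
  simp only [Fintype.card_prod, Fintype.card_bool]
  omega

theorem fits_node (hn : 2 ≤ n) : Fits (5 * Nat.clog 2 n) (Option (Fin n)) := by
  refine Fits.of_card ?_
  have := Nat.pow_le_pow_right (by omega : 0 < n) (by norm_num : 2 ≤ 5)
  simp only [Fintype.card_option, Fintype.card_fin]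
  nlinarith

theorem fits_pair (hn : 2 ≤ n) :
    Fits (5 * Nat.clog 2 n) (Option (Option (Fin n × Fin n))) := by
  refine Fits.of_card ?_
  have h3 := Nat.pow_le_pow_left hn 3
  have : n ^ 5 = n ^ 2 * n ^ 3 := by ring
  simp only [Fintype.card_option, Fintype.card_prod, Fintype.card_fin]
  nlinarith

theorem fits_word (hn : 2 ≤ n) :
    Fits (5 * Nat.clog 2 n) (Option (Fin n × Option (Fin n × Fin n))) := by
  refine Fits.of_card ?_
  have h2 := Nat.pow_le_pow_left hn 2
  have h3 := Nat.pow_le_pow_left hn 3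
  have : n ^ 5 = n ^ 2 * n ^ 3 := by ring
  simp only [Fintype.card_option, Fintype.card_prod, Fintype.card_fin]
  nlinarith [Nat.zero_le (n ^ 3)]

namespace Known

variable {σ τ M : Type} {r : ℕ} {f : SimpleGraph (Fin n) → Fin n → σ}

theorem neighborSet : Known B 0 (fun (G : SimpleGraph (Fin n)) v => G.neighborSet v) :=
  ⟨fun _ _ _ _ => false, fun _ h => h.1, fun _ _ => rfl⟩

theorem map (hf : Known B r f) (φ : Fin n → σ → τ) : Known B r (fun G v => φ v (f G v)) := by
  obtain ⟨S, dec, h⟩ := hf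
  exact ⟨S, fun v x => φ v (dec v x), fun G v => congrArg (φ v) (h G v)⟩

/-- One round of communication: every node `u` computes a message for every node `v` from the
value that it knows. -/
theorem comm (hf : Known B r f) (hM : Fits B M) (send : Fin n → σ → Fin n → M) :
    Known B (r + 1) (fun G v => (f G v, fun u => send u (f G u) v)) := by
  classical
  obtain ⟨S, dec, h⟩ := hf
  obtain ⟨hM, ⟨e⟩⟩ := hM
  let S' : Fin n → History n B → Fin n → Message B := fun u x v =>
    if x.2.length < r then S u x v else e (send u (dec u x) v)
  have hS : ∀ G v, historyAfter S' G r v = historyAfter S G r v := fun G v =>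
    historyAfter_congr (fun u x v hx => by simp [S', hx]) G r le_rfl v
  refine ⟨S', fun v x => (dec v (x.1, x.2.tail),
    fun u => Function.invFun e (x.2.head?.getD (fun _ _ => false) u)), fun G v => ?_⟩
  refine Prod.ext ?_ ?_
  · simp [historyAfter, hS, h]
  · funext u
    simp only [historyAfter, List.head?_cons, Option.getD_some, hS, S']
    rw [if_neg (by rw [length_historyAfter]; omega), h]
    exact Function.leftInverse_invFun e.injective _

/-- One more round, after which every node knows a value computed from its own previous one and
from the messages received. -/
theorem comm_map (hf : Known B r f) (hM : Fits B M) (send : Fin n → σ → Fin n → M)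
    (φ : Fin n → σ → (Fin n → M) → τ) :
    Known B (r + 1) (fun G v => φ v (f G v) (fun u => send u (f G u) v)) :=
  (hf.comm hM send).map fun v x => φ v x.1 x.2

theorem exists_algorithm {H : SimpleGraph (Fin n) → SimpleGraph (Fin n)}
    (h : Known B r (fun G v => (H G).neighborSet v)) :
    ∃ A : Algorithm n B, A.rounds = r ∧ ∀ G, A.Constructs G (H G) := by
  obtain ⟨S, dec, h⟩ := h
  refine ⟨historyAlgorithm S r dec, rfl, fun G v => ?_⟩
  rw [Algorithm.output, historyAlgorithm_stateAfter]
  exact h G v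

theorem mono (hf : Known B r f) {r' : ℕ} (h : r ≤ r') : Known B r' f := by
  induction r', h using Nat.le_induction with
  | base => exact hf
  | succ m _ ih =>
    have : Fits B Unit := ⟨inferInstance, ⟨⟨fun _ _ => false, fun _ _ _ => rfl⟩⟩⟩
    exact ih.comm_map this (fun _ _ _ => ()) fun _ x _ => x

/-- Routing along a symmetric relation of small degree: if every node `u` has to deliver the same
`p` words `P u` to each of the at most `m` nodes in the set `S u`, and `S` is symmetric, then
three rounds are enough when `m * m * p ≤ n`. The nodes first tell each other their positions in
each other's sets; the `j`-th word from `u` to `v` then travels through a relay node determined by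
`j`, the position of `u` in `S v` and the position of `v` in `S u`, and so no link is used
twice. -/
theorem multicast {W : Type} (hf : Known B r f) {m p : ℕ} (hmp : m * (m * p) ≤ n) (hm : 0 < m)
    (S : Fin n → σ → Finset (Fin n)) (P : Fin n → σ → Fin p → W)
    (hS : ∀ G u v, u ∈ S v (f G v) → v ∈ S u (f G u))
    (hcard : ∀ G v, (S v (f G v)).card ≤ m)
    (h₁ : Fits B (Fin m)) (h₂ : Fits B (Option (Fin n × W))) (h₃ : Fits B (Option W))
    [Nonempty W] :
    Known B (r + 3) (fun G v => (f G v,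
      fun u => if u ∈ S v (f G v) then some (P u (f G u)) else none)) := by
  classical
  obtain ⟨w₀⟩ := ‹Nonempty W›
  obtain ⟨ρ⟩ : Nonempty (Fin m × Fin m × Fin p ↪ Fin n) := by
    rw [Function.Embedding.nonempty_iff_card_le]
    simpa using hmp
  have hidx : ∀ T : Finset (Fin n), ∃ g : Fin n → Fin m, T.card ≤ m → Set.InjOn g T := by
    intro T
    by_cases hT : T.card ≤ m
    · have : Nonempty (T ↪ Fin m) := by
        rw [Function.Embedding.nonempty_iff_card_le]
        simpa using hT
      obtain ⟨e⟩ := this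
      refine ⟨fun x => if h : x ∈ T then e ⟨x, h⟩ else ⟨0, hm⟩, fun _ x hx y hy hxy => ?_⟩
      have hx' : x ∈ T := hx
      have hy' : y ∈ T := hy
      simpa [hx', hy'] using hxy
    · exact ⟨fun _ => ⟨0, hm⟩, fun h => absurd h hT⟩
  choose idx hidx using hidx
  have k₁ := hf.comm h₁ fun v x u => idx (S v x) u
  let Q : Fin n → σ → (Fin n → Fin m) → Fin n → Fin n × Fin p → Prop := fun u x R w y =>
    y.1 ∈ S u x ∧ ρ (R y.1, idx (S u x) y.1, y.2) = w
  have k₂ := k₁.comm h₂ fun u x w =>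
    if h : ∃ y, Q u x.1 x.2 w y then some (h.choose.1, P u x.1 h.choose.2) else none
  have k₃ := k₂.comm h₃ fun w x v =>
    if h : ∃ y : Fin n × W, x.2 y.1 = some (v, y.2) then some h.choose.2 else none
  have k₄ := k₃.map fun v x => (x.1.1.1, fun u => if u ∈ S v x.1.1.1 then
    some (fun j => (x.2 (ρ (idx (S v x.1.1.1) u, x.1.1.2 u, j))).getD w₀) else none)
  convert k₄ using 3 with G v
  refine Prod.ext rfl ?_
  funext u
  by_cases hu : u ∈ S v (f G v)
  swap
  · simp [hu]
  simp only [hu, if_true, Option.some.injEq]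
  funext j
  set w := ρ (idx (S v (f G v)) u, idx (S u (f G u)) v, j) with hw
  have key : ∀ u', u' ∈ S v (f G v) → idx (S v (f G v)) u' = idx (S v (f G v)) u → u' = u :=
    fun u' hu' he => hidx _ (hcard G v) hu' hu he
  have hQ : ∀ u' y, Q u' (f G u') (fun z => idx (S z (f G z)) u') w y → y.1 = v →
      u' = u ∧ y.2 = j := by
    rintro u' ⟨y, j'⟩ ⟨hy, hy'⟩ rfl
    have := ρ.injective hy'
    simp only [Prod.mk.injEq] at this
    exact ⟨key u' (hS G _ _ hy) this.1, this.2.2⟩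
  have hex : ∃ y, Q u (f G u) (fun z => idx (S z (f G z)) u) w y := ⟨(v, j), hS G _ _ hu, rfl⟩
  have hv : hex.choose = (v, j) := by
    have h1 := hex.choose_spec
    have := ρ.injective h1.2
    simp only [Prod.mk.injEq] at this
    exact Prod.ext (hidx _ (hcard G u) h1.1 (hS G _ _ hu) this.2.1) this.2.2
  have hex' : ∃ y : Fin n × W,
      (if h : ∃ z, Q y.1 (f G y.1) (fun z => idx (S z (f G z)) y.1) w z then
        some (h.choose.1, P y.1 (f G y.1) h.choose.2) else none) = some (v, y.2) := by
    refine ⟨(u, P u (f G u) j), ?_⟩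
    simp only [dif_pos hex, hv]
  rw [dif_pos hex']
  simp only [Option.getD_some]
  have h2 := hex'.choose_spec
  generalize hex'.choose = y at h2
  obtain ⟨u', x⟩ := y
  dsimp only at h2 ⊢
  split_ifs at h2 with h3
  have h4 := h3.choose_spec
  generalize h3.choose = z at h2 h4
  simp only [Option.some.injEq, Prod.mk.injEq] at h2
  obtain ⟨rfl, h6⟩ := hQ u' z h4 h2.1
  rw [← h2.2, h6]

end Known

end CongestedClique

/-! ### Hitting sets from a small family of hash functions -/

namespace CongestedClique

section Hash

open Finset

variable {F V : Type} [Field F] [Fintype F] [DecidableEq F]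

theorem sum_affine_mem (T : Finset F) (c : F) :
    ∑ β : F, (if c + β ∈ T then (1 : ℤ) else 0) = #T := by
  refine (Equiv.sum_comp (Equiv.addLeft c) fun β => if β ∈ T then (1 : ℤ) else 0).trans ?_
  simp

/-- Random affine maps are pairwise independent. -/
theorem sum_affine_mem_mem (T : Finset F) {u u' : F} (h : u ≠ u') :
    ∑ α : F, ∑ β : F, ((if α * u + β ∈ T then (1 : ℤ) else 0) *
      if α * u' + β ∈ T then 1 else 0) = (#T : ℤ) ^ 2 := by
  have h' : u' - u ≠ 0 := sub_ne_zero.2 h.symm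
  have h1 : ∀ α : F, ∑ β : F, ((if α * u + β ∈ T then (1 : ℤ) else 0) *
      (if α * u' + β ∈ T then 1 else 0)) =
      ∑ β : F, ((if β ∈ T then (1 : ℤ) else 0) * if β + α * (u' - u) ∈ T then 1 else 0) := by
    intro α
    refine Eq.trans (sum_congr rfl fun β _ => ?_) (Equiv.sum_comp (Equiv.addLeft (α * u)) _)
    change _ = (if α * u + β ∈ T then (1 : ℤ) else 0) *
      if α * u + β + α * (u' - u) ∈ T then 1 else 0
    rw [show α * u' + β = α * u + β + α * (u' - u) by ring]
  simp only [h1]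
  rw [sum_comm]
  simp only [← mul_sum]
  have h2 : ∀ β : F, ∑ α : F, (if β + α * (u' - u) ∈ T then (1 : ℤ) else 0) = #T := by
    intro β
    exact (Equiv.sum_comp (Equiv.mulRight₀ _ h')
      fun γ => if β + γ ∈ T then (1 : ℤ) else 0).trans (sum_affine_mem T β)
  simp only [h2, ← sum_mul]
  simp [sq]

variable (h : V → F → F) (T : Finset F)

/-- The set of the points `x` whose image under the hash function with the seed `s = (a, α, β)`,
that is `α * h x a + β`, lies in `T`. -/
abbrev hashMem (s : F × F × F) (x : V) : Prop := s.2.1 * h x s.1 + s.2.2 ∈ T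

theorem sum_hashMem (x : V) : ∑ s : F × F × F, (if hashMem h T s x then (1 : ℤ) else 0) =
    (Fintype.card F : ℤ) ^ 2 * #T := by
  simp only [hashMem, Fintype.sum_prod_type, sum_affine_mem]
  simp
  ring

theorem sum_hashMem_mul_le [DecidableEq V] {g : ℕ}
    (hg : ∀ x y, x ≠ y → #{a | h x a = h y a} ≤ g) (x y : V) :
    ∑ s : F × F × F, ((if hashMem h T s x then (1 : ℤ) else 0) *
      if hashMem h T s y then 1 else 0) ≤
    Fintype.card F * (#T : ℤ) ^ 2 + g * (Fintype.card F * #T) +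
      if x = y then (Fintype.card F : ℤ) ^ 2 * #T else 0 := by
  by_cases hxy : x = y
  · subst hxy
    have : ∀ s : F × F × F, ((if hashMem h T s x then (1 : ℤ) else 0) *
      if hashMem h T s x then 1 else 0) = if hashMem h T s x then 1 else 0 := by
      intro s; split_ifs <;> rfl
    simp only [this, sum_hashMem, if_true]
    have : 0 ≤ (Fintype.card F : ℤ) * (#T : ℤ) ^ 2 + g * (Fintype.card F * #T) := by positivity
    linarith
  rw [if_neg hxy, add_zero, Fintype.sum_prod_type]
  have key : ∀ a : F, ∑ z : F × F, ((if hashMem h T (a, z) x then (1 : ℤ) else 0) *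
      if hashMem h T (a, z) y then 1 else 0) ≤
      (#T : ℤ) ^ 2 + (if h x a = h y a then (1 : ℤ) else 0) * (Fintype.card F * #T) := by
    intro a
    rw [Fintype.sum_prod_type]
    simp only [hashMem]
    split_ifs with hc
    · simp only [hc]
      have : ∀ α β : F, ((if α * h y a + β ∈ T then (1 : ℤ) else 0) *
        if α * h y a + β ∈ T then 1 else 0) = if α * h y a + β ∈ T then 1 else 0 := by
        intro α β; split_ifs <;> rfl
      simp only [this, sum_affine_mem]
      simp
    · rw [sum_affine_mem_mem T hc]
      simp
  refine (sum_le_sum fun a _ => key a).trans ?_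
  rw [sum_add_distrib, ← sum_mul]
  have : ∑ a : F, (if h x a = h y a then (1 : ℤ) else 0) ≤ g := by
    rw [sum_boole]
    exact_mod_cast hg x y hxy
  simp only [sum_const, card_univ, nsmul_eq_mul]
  gcongr

/-- Chebyshev's inequality: few seeds miss a given set `S`. -/
theorem card_disjoint_hashMem_le [DecidableEq V] {g : ℕ}
    (hg : ∀ x y, x ≠ y → #{a | h x a = h y a} ≤ g)
    (S : Finset V) (hS : 0 < #S) (hT : 0 < #T) :
    #{s : F × F × F | ∀ x ∈ S, ¬ hashMem h T s x} * (#S * #T) ≤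
      Fintype.card F ^ 3 * (Fintype.card F + g * #S) := by
  set q : ℤ := (Fintype.card F : ℤ) with hq
  set t : ℤ := (#T : ℤ) with ht
  set d : ℤ := (#S : ℤ) with hd
  let X : F × F × F → ℤ := fun s => ∑ x ∈ S, if hashMem h T s x then (1 : ℤ) else 0
  have h1 : ∑ s, X s = d * (q ^ 2 * t) := by
    simp only [X]
    rw [sum_comm]
    simp only [sum_hashMem]
    simp [hd, hq, ht]
  have h2 : ∑ s, X s ^ 2 ≤ d * d * (q * t ^ 2 + g * (q * t)) + d * (q ^ 2 * t) := by
    simp only [X, sq, sum_mul_sum]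
    rw [sum_comm]
    calc ∑ x ∈ S, ∑ s : F × F × F, ∑ y ∈ S, ((if hashMem h T s x then (1 : ℤ) else 0) *
          if hashMem h T s y then 1 else 0)
        = ∑ x ∈ S, ∑ y ∈ S, ∑ s : F × F × F, ((if hashMem h T s x then (1 : ℤ) else 0) *
          if hashMem h T s y then 1 else 0) := sum_congr rfl fun x _ => sum_comm
      _ ≤ ∑ x ∈ S, ∑ y ∈ S, (q * t ^ 2 + g * (q * t) + if x = y then q ^ 2 * t else 0) :=
          sum_le_sum fun x _ => sum_le_sum fun y _ => sum_hashMem_mul_le h T hg x y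
      _ = _ := by
          simp [sum_add_distrib, ← hd, sq]
          ring
  have h3 : ∑ s, (q * X s - d * t) ^ 2 ≤ d * q ^ 4 * t + g * d ^ 2 * q ^ 3 * t := by
    have : ∀ s, (q * X s - d * t) ^ 2 = q ^ 2 * X s ^ 2 - 2 * q * d * t * X s + d ^ 2 * t ^ 2 :=
      fun s => by ring
    simp only [this, sum_add_distrib, sum_sub_distrib, ← mul_sum, h1]
    have hc : (Fintype.card (F × F × F) : ℤ) = q ^ 3 := by simp [hq]; ring
    simp only [sum_const, card_univ, nsmul_eq_mul, hc]
    nlinarith [mul_le_mul_of_nonneg_left h2 (sq_nonneg q)]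
  have h4 : (#{s : F × F × F | ∀ x ∈ S, ¬ hashMem h T s x} : ℤ) * (d * t) ^ 2 ≤
      ∑ s, (q * X s - d * t) ^ 2 := by
    rw [← nsmul_eq_mul, ← sum_const]
    refine (sum_le_sum fun s hs => ?_).trans
      (sum_le_sum_of_subset_of_nonneg (subset_univ _) fun _ _ _ => sq_nonneg _)
    have : X s = 0 := sum_eq_zero fun x hx => if_neg ((mem_filter.1 hs).2 x hx)
    rw [this]
    apply le_of_eq
    ring
  have hdt : 0 < d * t := by positivity
  have h5 := h4.trans h3
  have h6 : (#{s : F × F × F | ∀ x ∈ S, ¬ hashMem h T s x} : ℤ) * (d * t) ≤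
      q ^ 3 * (q + g * d) := by
    refine le_of_mul_le_mul_right ?_ hdt
    linarith
  rw [hd, ht, hq] at h6
  exact_mod_cast h6

end Hash

open Finset in
/-- A family of `n` sets, one for each node, such that for any given sets `W v` of `d` nodes one
member of the family is small and meets most of the given sets: its part within a given set `Z`
and the number of the sets that it misses are smaller than `Z` and the number of all the sets by a
factor of about `e`. -/
def IsHittingFamily {n : ℕ} (e d g : ℕ) (Zs : Fin n → Finset (Fin n)) : Prop :=
  ∀ (Z I : Finset (Fin n)) (W : Fin n → Finset (Fin n)), (∀ v ∈ I, #(W v) = d) →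
    ∃ w, e * (#(Z ∩ Zs w) + #{v ∈ I | Disjoint (W v) (Zs w)}) ≤ #Z + (1 + g) * #I

open Finset in
/-- Hitting families come from finite fields with `q = t * e` elements, the nodes being viewed as
polynomials of degree less than `g`. -/
theorem exists_hitting_family (F : Type) [Field F] [Fintype F] {n t e d g : ℕ}
    (hq : Fintype.card F = t * e) (he : 0 < e) (ht : e ≤ t) (hd : e ^ 2 ≤ d)
    (hn : Fintype.card F ^ 3 ≤ n) (hn' : n ≤ Fintype.card F ^ g) :
    ∃ Zs : Fin n → Finset (Fin n), IsHittingFamily e d g Zs := by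
  classical
  obtain ⟨p⟩ : Nonempty (Fin n ↪ Polynomial.degreeLT F g) := by
    let b := (Polynomial.degreeLTEquiv F g).toEquiv
    have : Nonempty (Fin n ↪ (Fin g → F)) := by
      rw [Function.Embedding.nonempty_iff_card_le]
      simpa using hn'
    exact this.map fun e => e.trans b.symm.toEmbedding
  let h : Fin n → F → F := fun x a => (p x : Polynomial F).eval a
  have hg : ∀ x y, x ≠ y → #{a | h x a = h y a} ≤ g := by
    intro x y hxy
    have hne : (p x : Polynomial F) - p y ≠ 0 :=
      sub_ne_zero.2 fun h => hxy (p.injective (Subtype.ext h))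
    have hdeg : ((p x : Polynomial F) - p y).natDegree ≤ g := by
      have := Polynomial.mem_degreeLT.1 ((p x - p y : Polynomial.degreeLT F g)).2
      exact Polynomial.natDegree_le_iff_degree_le.2 this.le
    refine le_trans ?_ ((Polynomial.card_roots' _).trans hdeg)
    refine le_trans (card_le_card (t := ((p x : Polynomial F) - p y).roots.toFinset) ?_)
      (Multiset.toFinset_card_le _)
    intro a ha
    simp only [mem_filter, mem_univ, true_and, h] at ha
    simp [hne, Polynomial.IsRoot, ha]
  set q := Fintype.card F with hqF
  have hq0 : 0 < q := Fintype.card_pos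
  have ht0 : 0 < t := he.trans_le ht
  obtain ⟨T, -, hT⟩ := exists_subset_card_eq (s := (univ : Finset F)) (n := t) (by
    rw [card_univ, ← hqF, hq]; exact Nat.le_mul_of_pos_right _ he)
  have hseed : Fintype.card (F × F × F) = q ^ 3 := by simp [hqF]; ring
  obtain ⟨π⟩ : Nonempty (F × F × F ↪ Fin n) := by
    rw [Function.Embedding.nonempty_iff_card_le, hseed]
    simpa using hn
  let Y : F × F × F → Finset (Fin n) := fun s => {x | hashMem h T s x}
  refine ⟨fun w => Y (Function.invFun π w), fun Z I W hW => ?_⟩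
  suffices ∃ s, e * (#(Z ∩ Y s) + #{v ∈ I | Disjoint (W v) (Y s)}) ≤ #Z + (1 + g) * #I by
    obtain ⟨s, hs⟩ := this
    refine ⟨π s, ?_⟩
    simp only [Function.leftInverse_invFun π.injective s]
    exact hs
  have hZ : ∑ s, #(Z ∩ Y s) * e = q ^ 3 * #Z := by
    have h1 : ∑ s, #(Z ∩ Y s) = #Z * (q ^ 2 * t) := by
      have : ∀ s, (#(Z ∩ Y s) : ℤ) = ∑ x ∈ Z, if hashMem h T s x then (1 : ℤ) else 0 := by
        intro s
        simp only [Y, sum_boole, inter_filter, inter_univ]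
      have h2 : ∑ s, (#(Z ∩ Y s) : ℤ) = #Z * (q ^ 2 * t) := by
        simp only [this]
        rw [sum_comm]
        simp only [sum_hashMem, ← hqF, hT]
        simp
      exact_mod_cast h2
    rw [← sum_mul, h1, pow_succ q 2]
    nth_rewrite 3 [hq]
    ring
  have hI : ∑ s, #{v ∈ I | Disjoint (W v) (Y s)} * e ≤ q ^ 3 * ((1 + g) * #I) := by
    have hv : ∀ v ∈ I, #{s | Disjoint (W v) (Y s)} * e ≤ q ^ 3 * (1 + g) := by
      intro v hv
      have hd0 : 0 < d := (pow_pos he 2).trans_le hd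
      have h1 := card_disjoint_hashMem_le h T hg (W v) (by rw [hW v hv]; exact hd0)
        (by rw [hT]; exact ht0)
      rw [hW v hv, hT, ← hqF] at h1
      have h2 : (univ.filter fun s => Disjoint (W v) (Y s)) =
          univ.filter fun s : F × F × F => ∀ x ∈ W v, ¬ hashMem h T s x := by
        refine filter_congr fun s _ => ?_
        simp [Y, disjoint_left]
      rw [h2]
      refine le_of_mul_le_mul_right ?_ (mul_pos hd0 ht0)
      calc _ = #{s : F × F × F | ∀ x ∈ W v, ¬ hashMem h T s x} * (d * t) * e := by ring
        _ ≤ q ^ 3 * (q + g * d) * e := by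
          refine Nat.mul_le_mul_right _ ?_
          convert h1
        _ = q ^ 3 * (q * e + g * (d * e)) := by ring
        _ ≤ q ^ 3 * (d * t + g * (d * t)) := by
          have : q * e ≤ d * t := by
            rw [hq]
            calc t * e * e = t * e ^ 2 := by ring
              _ ≤ t * d := by gcongr
              _ = d * t := by ring
          gcongr
        _ = _ := by ring
    have h1 : ∑ s, #{v ∈ I | Disjoint (W v) (Y s)} = ∑ v ∈ I, #{s | Disjoint (W v) (Y s)} := by
      simp only [card_filter]
      rw [sum_comm]
    rw [← sum_mul, h1, sum_mul]
    refine (sum_le_sum hv).trans ?_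
    simp
    apply le_of_eq
    ring
  have htot : ∑ s, e * (#(Z ∩ Y s) + #{v ∈ I | Disjoint (W v) (Y s)}) ≤
      ∑ _s : F × F × F, (#Z + (1 + g) * #I) := by
    simp only [sum_const, card_univ, hseed, smul_eq_mul, mul_add]
    rw [sum_add_distrib]
    refine add_le_add ?_ ?_
    · simp only [mul_comm e, hZ, le_refl]
    · simpa only [mul_comm e, mul_add] using hI
  obtain ⟨s, -, hs⟩ := exists_le_of_sum_le ⟨(0, 0, 0), mem_univ _⟩ htot
  exact ⟨s, hs⟩

/-- In two rounds the nodes agree on a member of a family `Zs` of candidate sets that is best for a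
cost which is a sum of contributions of at most two bits of the nodes: node `w` adds up the cost
of `Zs w` and announces it. -/
theorem Known.argmin {n B r : ℕ} {σ : Type} {f : SimpleGraph (Fin n) → Fin n → σ}
    (hf : Known B r f) (h₁ : Fits B (Bool × Bool)) (h₂ : Fits B (Fin (2 * n + 1)))
    (c : Fin n → σ → Fin n → Bool × Bool) :
    ∃ w : SimpleGraph (Fin n) → Fin n → Fin n,
      Known B (r + 2) (fun G v => (f G v, w G v)) ∧
      (∀ G u v, w G u = w G v) ∧
      ∀ G v w', ∑ u, ((c u (f G u) (w G v)).1.toNat + (c u (f G u) (w G v)).2.toNat) ≤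
        ∑ u, ((c u (f G u) w').1.toNat + (c u (f G u) w').2.toNat) := by
  have k₁ := hf.comm h₁ c
  let cost : (Fin n → Bool × Bool) → ℕ := fun m => ∑ u, ((m u).1.toNat + (m u).2.toNat)
  have hcost : ∀ m, cost m < 2 * n + 1 := by
    intro m
    have : cost m ≤ ∑ _u : Fin n, 2 := Finset.sum_le_sum fun u _ => by
      have := Bool.toNat_le (m u).1
      have := Bool.toNat_le (m u).2
      omega
    simp at this
    omega
  have k₂ := k₁.comm h₂ fun w x _ => ⟨cost x.2, hcost x.2⟩
  have hmin : ∀ (_ : Nonempty (Fin n)) (m : Fin n → Fin (2 * n + 1)), ∃ w, ∀ w', m w ≤ m w' := by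
    intro _ m
    exact Finite.exists_min m
  choose best hbest using hmin
  have k₃ := k₂.map fun v x => (x.1.1, best ⟨v⟩ x.2)
  exact ⟨_, k₃, fun G u v => rfl, fun G v w' => hbest ⟨v⟩
    (fun w => ⟨cost fun u => c u (f G u) w, hcost _⟩) w'⟩

open Finset in
/-- In two rounds the nodes agree on a good member of a hitting family, for the set `Zset` of the
nodes with the property `Z` and the sets `W u` of the nodes `u` with the property `I`. -/
theorem Known.hittingSet {n B r e d g : ℕ} {σ : Type} {f : SimpleGraph (Fin n) → Fin n → σ}
    (hf : Known B r f) (h₁ : Fits B (Bool × Bool)) (h₂ : Fits B (Fin (2 * n + 1)))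
    {Zs : Fin n → Finset (Fin n)} (hZs : IsHittingFamily e d g Zs)
    (Z I : Fin n → σ → Prop) (W : Fin n → σ → Finset (Fin n)) :
    ∃ w : SimpleGraph (Fin n) → Fin n → Fin n,
      Known B (r + 2) (fun G v => (f G v, w G v)) ∧
      (∀ G u v, w G u = w G v) ∧
      ∀ G v (Zset Iset : Finset (Fin n)), (∀ u, u ∈ Zset ↔ Z u (f G u)) →
        (∀ u, u ∈ Iset ↔ I u (f G u)) → (∀ u ∈ Iset, #(W u (f G u)) = d) →
        e * (#(Zset ∩ Zs (w G v)) + #{u ∈ Iset | Disjoint (W u (f G u)) (Zs (w G v))}) ≤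
        #Zset + (1 + g) * #Iset := by
  classical
  obtain ⟨w, hw, hc, hmin⟩ := hf.argmin h₁ h₂ fun u x w =>
    (decide (Z u x ∧ u ∈ Zs w), decide (I u x ∧ Disjoint (W u x) (Zs w)))
  refine ⟨w, hw, hc, fun G v Zset Iset hZ hI hW => ?_⟩
  obtain ⟨w', hw'⟩ := hZs Zset Iset (fun u => W u (f G u)) hW
  refine le_trans (Nat.mul_le_mul_left e ?_) hw'
  have key : ∀ w, ∑ u, ((decide (Z u (f G u) ∧ u ∈ Zs w)).toNat +
      (decide (I u (f G u) ∧ Disjoint (W u (f G u)) (Zs w))).toNat) =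
      #(Zset ∩ Zs w) + #{u ∈ Iset | Disjoint (W u (f G u)) (Zs w)} := by
    intro w
    have h1 : Zset ∩ Zs w = ({u | Z u (f G u) ∧ u ∈ Zs w} : Finset (Fin n)) := by
      ext u; simp [hZ]
    have h2 : ({u ∈ Iset | Disjoint (W u (f G u)) (Zs w)} : Finset (Fin n)) =
        ({u | I u (f G u) ∧ Disjoint (W u (f G u)) (Zs w)} : Finset (Fin n)) := by
      ext u; simp [hI]
    rw [h1, h2]
    simp only [sum_add_distrib, card_filter, Bool.toNat, Bool.cond_decide]
  have := hmin G v w'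
  rwa [key, key] at this

end CongestedClique

/-! ### Balls and their edges -/

namespace SimpleGraph

open Finset

variable {V : Type*} [Fintype V] (G : SimpleGraph V)

open Classical in
/-- The vertices at distance at most `r` from `v`. -/
noncomputable def hopBall (r : ℕ) (v : V) : Finset V :=
  {x | ∃ p : G.Walk v x, p.length ≤ r}

variable {G}

theorem mem_hopBall {r : ℕ} {v x : V} : x ∈ G.hopBall r v ↔ ∃ p : G.Walk v x, p.length ≤ r := by
  simp [hopBall]

theorem self_mem_hopBall (r : ℕ) (v : V) : v ∈ G.hopBall r v :=
  mem_hopBall.2 ⟨.nil, by simp⟩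

theorem mem_hopBall_comm {r : ℕ} {v x : V} : x ∈ G.hopBall r v ↔ v ∈ G.hopBall r x := by
  simp only [mem_hopBall]
  exact ⟨fun ⟨p, hp⟩ => ⟨p.reverse, by simpa⟩, fun ⟨p, hp⟩ => ⟨p.reverse, by simpa⟩⟩

theorem hopBall_mono {r s : ℕ} (h : r ≤ s) (v : V) : G.hopBall r v ⊆ G.hopBall s v := by
  intro x hx
  obtain ⟨p, hp⟩ := mem_hopBall.1 hx
  exact mem_hopBall.2 ⟨p, hp.trans h⟩

theorem mem_hopBall_add {r s : ℕ} {v x : V} :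
    x ∈ G.hopBall (r + s) v ↔ ∃ w ∈ G.hopBall r v, x ∈ G.hopBall s w := by
  simp only [mem_hopBall]
  constructor
  · rintro ⟨p, hp⟩
    exact ⟨p.getVert r, ⟨p.take r, by simp [Walk.take_length]⟩,
      ⟨p.drop r, by rw [Walk.drop_length]; omega⟩⟩
  · rintro ⟨w, ⟨p, hp⟩, q, hq⟩
    exact ⟨p.append q, by rw [Walk.length_append]; omega⟩

theorem mem_hopBall_zero {v x : V} : x ∈ G.hopBall 0 v ↔ x = v := by
  rw [mem_hopBall]
  constructor
  · rintro ⟨p, hp⟩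
    exact (Walk.eq_of_length_eq_zero (Nat.le_zero.1 hp)).symm
  · rintro rfl
    exact ⟨.nil, by simp⟩

theorem mem_hopBall_one {v x : V} : x ∈ G.hopBall 1 v ↔ x = v ∨ G.Adj v x := by
  rw [mem_hopBall]
  constructor
  · rintro ⟨p, hp⟩
    rcases Nat.le_one_iff_eq_zero_or_eq_one.1 hp with h | h
    · exact Or.inl (Walk.eq_of_length_eq_zero h).symm
    · exact Or.inr (Walk.adj_of_length_eq_one h)
  · rintro (rfl | h)
    · exact ⟨.nil, by simp⟩
    · exact ⟨h.toWalk, by simp⟩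

theorem mem_hopBall_succ {r : ℕ} {v x : V} :
    x ∈ G.hopBall (r + 1) v ↔ ∃ w ∈ G.hopBall r v, x = w ∨ G.Adj w x := by
  simp only [mem_hopBall_add, mem_hopBall_one]

theorem eq_or_exists_of_mem_hopBall_succ {r : ℕ} {v x : V} (h : x ∈ G.hopBall (r + 1) v) :
    x = v ∨ ∃ w ∈ G.hopBall r v, G.Adj w x := by
  induction r with
  | zero =>
    obtain ⟨w, hw, h⟩ := mem_hopBall_succ.1 h
    rcases h with rfl | h
    · exact Or.inl (mem_hopBall_zero.1 hw)
    · exact Or.inr ⟨w, hw, h⟩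
  | succ r ih =>
    obtain ⟨w, hw, h⟩ := mem_hopBall_succ.1 h
    rcases h with rfl | h
    · rcases ih hw with h | ⟨w', hw', h⟩
      · exact Or.inl h
      · exact Or.inr ⟨w', hopBall_mono (Nat.le_succ r) _ hw', h⟩
    · exact Or.inr ⟨w, hw, h⟩

variable (G)

open Classical in
/-- The edges at the vertices of `G.hopBall r v`, as pairs `(x, y)` with `x` in the ball. -/
noncomputable def ballDarts (r : ℕ) (v : V) : Finset (V × V) :=
  {e | e.1 ∈ G.hopBall r v ∧ G.Adj e.1 e.2}

variable {G}

theorem mem_ballDarts {r : ℕ} {v x y : V} :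
    (x, y) ∈ G.ballDarts r v ↔ x ∈ G.hopBall r v ∧ G.Adj x y := by
  simp [ballDarts]

theorem ballDarts_add [DecidableEq V] (r s : ℕ) (v : V) :
    G.ballDarts (r + s) v = (G.hopBall r v).biUnion (G.ballDarts s) := by
  ext ⟨x, y⟩
  simp only [mem_ballDarts, mem_hopBall_add, mem_biUnion]
  aesop

theorem card_hopBall_succ_le (r : ℕ) (v : V) :
    #(G.hopBall (r + 1) v) ≤ #(G.ballDarts r v) + 1 := by
  classical
  calc _ ≤ #(insert v ((G.ballDarts r v).image Prod.snd)) := by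
        refine card_le_card fun x hx => ?_
        rcases eq_or_exists_of_mem_hopBall_succ hx with rfl | ⟨w, hw, h⟩
        · exact mem_insert_self _ _
        · exact mem_insert_of_mem (mem_image.2 ⟨(w, x), mem_ballDarts.2 ⟨hw, h⟩, rfl⟩)
    _ ≤ _ := (card_insert_le _ _).trans (Nat.add_le_add_right card_image_le _)

theorem card_ballDarts_le (r : ℕ) (v : V) :
    #(G.ballDarts r v) ≤ #(G.hopBall (r + 1) v) ^ 2 := by
  classical
  rw [sq, ← card_product]
  refine card_le_card ?_
  rintro ⟨x, y⟩ h
  obtain ⟨hx, h⟩ := mem_ballDarts.1 h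
  exact mem_product.2 ⟨hopBall_mono (Nat.le_succ r) _ hx, mem_hopBall_succ.2 ⟨x, hx, Or.inr h⟩⟩

/-- The graph with a given set of directed edges. -/
def ofDarts (D : Finset (V × V)) : SimpleGraph V := fromRel fun x y => (x, y) ∈ D

theorem ofDarts_ballDarts_le (r : ℕ) (v : V) : ofDarts (G.ballDarts r v) ≤ G := by
  intro x y h
  obtain ⟨-, h | h⟩ := (fromRel_adj _ _ _).1 h
  · exact (mem_ballDarts.1 h).2
  · exact (mem_ballDarts.1 h).2.symm

theorem ofDarts_ballDarts_adj {r : ℕ} {v x y : V} (hx : x ∈ G.hopBall r v) :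
    (ofDarts (G.ballDarts r v)).Adj x y ↔ G.Adj x y :=
  ⟨fun h => ofDarts_ballDarts_le r v h,
    fun h => (fromRel_adj _ _ _).2 ⟨h.ne, Or.inl (mem_ballDarts.2 ⟨hx, h⟩)⟩⟩

/-- The edges at the vertices of a ball determine the ball, and even the next larger one. -/
theorem hopBall_ofDarts_ballDarts {r s : ℕ} (h : s ≤ r + 1) (v : V) :
    (ofDarts (G.ballDarts r v)).hopBall s v = G.hopBall s v := by
  induction s with
  | zero => ext; simp only [mem_hopBall_zero]
  | succ s ih =>
    ext x
    simp only [mem_hopBall_succ, ih (by omega)]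
    refine exists_congr fun w => and_congr_right fun hw => or_congr_right ?_
    exact ofDarts_ballDarts_adj (hopBall_mono (by omega) _ hw)

/-! ### Spanners -/

theorem edist_le_mul_edist {H : SimpleGraph V} {t : ℕ} (ht : t ≠ 0)
    (h : ∀ u v, G.Adj u v → H.edist u v ≤ t) (u v : V) : H.edist u v ≤ t * G.edist u v := by
  by_cases huv : G.Reachable u v
  · obtain ⟨p, hp⟩ := huv.exists_walk_length_eq_edist
    rw [← hp]
    clear hp huv
    induction p with
    | nil => simp
    | @cons a b c hab p ih =>
      refine (SimpleGraph.edist_triangle (v := b)).trans ?_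
      rw [Walk.length_cons]
      push_cast
      rw [mul_add, mul_one, add_comm]
      exact add_le_add ih (h a b hab)
  · rw [edist_eq_top_of_not_reachable huv, ENat.mul_top (by exact_mod_cast ht)]
    exact le_top

/-- The graph in which every vertex `v` is joined to the vertices in the set `O v`. -/
def ofChoices (O : V → Finset V) : SimpleGraph V := fromRel fun u v => v ∈ O u

omit [Fintype V] in
theorem ofChoices_le {O : V → Finset V} (h : ∀ u, ∀ v ∈ O u, G.Adj u v) : ofChoices O ≤ G := by
  intro u v huv
  obtain ⟨-, h' | h'⟩ := (fromRel_adj _ _ _).1 huv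
  · exact h u v h'
  · exact (h v u h').symm

theorem ncard_edgeSet_ofChoices_le (O : V → Finset V) :
    (ofChoices O).edgeSet.ncard ≤ ∑ v, #(O v) := by
  classical
  rw [← card_sigma]
  refine (Set.ncard_le_ncard (t := (((univ : Finset V).sigma O).image
    fun x => s(x.1, x.2) : Finset (Sym2 V))) ?_ (finite_toSet _)).trans ?_
  · intro e
    induction e with | _ u v
    intro h
    obtain ⟨-, h | h⟩ := (fromRel_adj _ _ _).1 ((mem_edgeSet _).1 h)
    · exact mem_coe.2 (mem_image.2 ⟨⟨u, v⟩, by simpa using h, rfl⟩)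
    · exact mem_coe.2 (mem_image.2 ⟨⟨v, u⟩, by simpa using h, Sym2.eq_swap⟩)
  · rw [Set.ncard_coe_finset]
    exact card_image_le

/-- A path can be described by telling each of its vertices its successor. -/
theorem exists_successor {v z : V} {r : ℕ} (h : z ∈ G.hopBall r v) :
    ∃ nxt : V → Option V, (∀ x y, nxt x = some y → G.Adj x y) ∧
      #{x | (nxt x).isSome} ≤ r ∧
      ∀ H : SimpleGraph V, (∀ x y, nxt x = some y → H.Adj x y) → H.edist v z ≤ r := by
  classical
  obtain ⟨p, hp⟩ := mem_hopBall.1 h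
  suffices ∀ p : G.Walk v z, p.IsPath → ∃ nxt : V → Option V,
      (∀ x y, nxt x = some y → G.Adj x y) ∧ (∀ x, x ∉ p.support → nxt x = none) ∧
      #{x | (nxt x).isSome} ≤ p.length ∧
      ∀ H : SimpleGraph V, (∀ x y, nxt x = some y → H.Adj x y) → H.edist v z ≤ p.length by
    have hl := p.length_bypass_le_length.trans hp
    obtain ⟨nxt, h1, -, h3, h4⟩ := this p.bypass p.bypass_isPath
    exact ⟨nxt, h1, h3.trans hl, fun H hH => (h4 H hH).trans (by exact_mod_cast hl)⟩
  clear hp p h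
  intro p
  induction p with
  | nil => exact fun _ => ⟨fun _ => none, by simp, by simp, by simp, by simp⟩
  | @cons a b c hab p ih =>
    intro hp
    rw [Walk.cons_isPath_iff] at hp
    obtain ⟨nxt, h1, h2, h3, h4⟩ := ih hp.1
    have ha := h2 a hp.2
    refine ⟨Function.update nxt a (some b), ?_, ?_, ?_, ?_⟩
    · intro x y hxy
      by_cases hx : x = a
      · subst hx
        simp only [Function.update_self, Option.some.injEq] at hxy
        exact hxy ▸ hab
      · rw [Function.update_of_ne hx] at hxy
        exact h1 x y hxy
    · intro x hx
      rw [Walk.support_cons, List.mem_cons, not_or] at hx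
      rw [Function.update_of_ne hx.1]
      exact h2 x hx.2
    · calc _ ≤ #(insert a ({x | (nxt x).isSome} : Finset V)) := by
            refine card_le_card fun x hx => ?_
            by_cases hxa : x = a
            · simp [hxa]
            · simpa [Function.update_of_ne hxa, hxa] using hx
        _ ≤ _ := (card_insert_le _ _).trans (by rw [Walk.length_cons]; omega)
    · intro H hH
      refine (SimpleGraph.edist_triangle (v := b)).trans ?_
      rw [Walk.length_cons]
      push_cast
      rw [add_comm]
      refine add_le_add (h4 H fun x y hxy => hH x y ?_) ?_
      · rw [Function.update_of_ne, hxy]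
        rintro rfl
        rw [ha] at hxy
        cases hxy
      · exact (edist_eq_one_iff_adj.2 (hH a b (by simp))).le

end SimpleGraph

/-! ### A deterministic local spanner construction -/

namespace SimpleGraph

open Finset

section Pick

variable {V : Type*}

/-- The region of a vertex, empty for an inactive one. -/
def regionOf (I : V → Option (Finset V)) (w : V) : Finset V := (I w).getD ∅

/-- Every active vertex outside `C` has a region that meets the region of a member of `C`. -/
def Exhausts (I : V → Option (Finset V)) (C : Finset V) : Prop :=
  ∀ w, (I w).isSome → w ∈ C ∨ ∃ w' ∈ C, ¬ Disjoint (regionOf I w') (regionOf I w)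

theorem exists_pick [Fintype V] (σ : ℕ) (I : V → Option (Finset V)) :
    ∃ C : Finset V, (∀ w ∈ C, (I w).isSome) ∧ (C : Set V).PairwiseDisjoint (regionOf I) ∧
      #C ≤ σ ∧ (#C = σ ∨ Exhausts I C) := by
  classical
  let P : Finset V → Prop := fun C =>
    (∀ w ∈ C, (I w).isSome) ∧ (C : Set V).PairwiseDisjoint (regionOf I) ∧ #C ≤ σ
  obtain ⟨C, hC, hmax⟩ := exists_max_image (univ.filter P) card
    ⟨∅, mem_filter.2 ⟨mem_univ _, by simp [P]⟩⟩
  obtain ⟨h1, h2, h3⟩ := (mem_filter.1 hC).2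
  refine ⟨C, h1, h2, h3, ?_⟩
  by_contra! hcon
  obtain ⟨hσ, hex⟩ := hcon
  simp only [Exhausts, not_forall, not_or, not_exists, not_and, not_not] at hex
  obtain ⟨w, hw, hwC, hdis⟩ := hex
  have : P (insert w C) := by
    refine ⟨?_, ?_, ?_⟩
    · intro x hx
      rcases mem_insert.1 hx with rfl | hx
      · exact hw
      · exact h1 x hx
    · rw [coe_insert, Set.pairwiseDisjoint_insert]
      exact ⟨h2, fun x hx _ => (hdis x hx).symm⟩
    · rw [card_insert_of_notMem hwC]
      omega
  have := hmax _ (mem_filter.2 ⟨mem_univ _, this⟩)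
  rw [card_insert_of_notMem hwC] at this
  omega

/-- At most `σ` active vertices with pairwise disjoint regions, chosen so that no further one can
be added. -/
noncomputable def pick [Fintype V] (σ : ℕ) (I : V → Option (Finset V)) : Finset V :=
  (exists_pick σ I).choose

end Pick

variable {V : Type*} [Fintype V] (G : SimpleGraph V) (σ : ℕ)

open Classical in
/-- The regions `D` as seen from `u`: only its neighbours count. -/
noncomputable def regionsAt (D : V → Option (Finset V)) (u w : V) : Option (Finset V) :=
  if G.Adj u w then D w else none

open Classical in
/-- The region of a vertex after a given number of steps, `none` if it is no longer active. In each
step, an active vertex picks up to `σ` active neighbours with disjoint regions. If every active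
neighbour is then accounted for, it becomes inactive; otherwise its new region is the union of the
regions of the picked neighbours, and so its size is multiplied by `σ`. -/
noncomputable def region : ℕ → V → Option (Finset V)
  | 0, u => some {u}
  | i + 1, u =>
    if (region i u).isSome ∧
        ¬ Exhausts (G.regionsAt (region i) u) (pick σ (G.regionsAt (region i) u)) then
      some ((pick σ (G.regionsAt (region i) u)).biUnion (regionOf (G.regionsAt (region i) u)))
    else none

/-- The neighbours that an active vertex picks in a given step. -/
noncomputable def picked (i : ℕ) (u : V) : Finset V :=
  if (G.region σ i u).isSome then pick σ (G.regionsAt (G.region σ i) u) else ∅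

variable {G σ}

omit [Fintype V] in
theorem regionOf_regionsAt {D : V → Option (Finset V)} {u w : V} {R : Finset V}
    (hw : G.Adj u w) (hR : D w = some R) : regionOf (G.regionsAt D u) w = R := by
  simp [regionOf, regionsAt, hw, hR]

theorem exists_region_of_mem_pick {D : V → Option (Finset V)} {u w : V}
    (h : w ∈ pick σ (G.regionsAt D u)) : G.Adj u w ∧ ∃ R, D w = some R := by
  have := (exists_pick σ (G.regionsAt D u)).choose_spec.1 w h
  unfold regionsAt at this
  split_ifs at this with h'
  · exact ⟨h', Option.isSome_iff_exists.1 this⟩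
  · simp at this

theorem adj_of_mem_picked {i : ℕ} {u w : V} (h : w ∈ G.picked σ i u) : G.Adj u w := by
  unfold picked at h
  split_ifs at h with h'
  · exact (exists_region_of_mem_pick h).1
  · simp at h

theorem card_picked_le (i : ℕ) (u : V) : #(G.picked σ i u) ≤ σ := by
  unfold picked
  split_ifs with h'
  · exact (exists_pick σ (G.regionsAt (G.region σ i) u)).choose_spec.2.2.1
  · simp

theorem region_succ_eq_some {i : ℕ} {u : V} {R : Finset V} [DecidableEq V]
    (h : G.region σ (i + 1) u = some R) :
    (G.region σ i u).isSome ∧ #(G.picked σ i u) = σ ∧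
      (G.picked σ i u : Set V).PairwiseDisjoint (regionOf (G.regionsAt (G.region σ i) u)) ∧
      R = (G.picked σ i u).biUnion (regionOf (G.regionsAt (G.region σ i) u)) := by
  classical
  rw [region] at h
  split_ifs at h with h'
  have hp : G.picked σ i u = pick σ (G.regionsAt (G.region σ i) u) := if_pos h'.1
  have hs := (exists_pick σ (G.regionsAt (G.region σ i) u)).choose_spec
  refine ⟨h'.1, ?_, ?_, ?_⟩
  · rw [hp]; exact hs.2.2.2.resolve_right h'.2
  · rw [hp]; exact hs.2.1
  · rw [hp]
    convert (Option.some.inj h).symm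

theorem pow_le_card_region {i : ℕ} {u : V} {R : Finset V} (h : G.region σ i u = some R) :
    σ ^ i ≤ #R := by
  classical
  induction i generalizing u R with
  | zero =>
    cases h
    simp
  | succ i ih =>
    obtain ⟨hs, h1, h2, rfl⟩ := region_succ_eq_some h
    rw [card_biUnion h2, pow_succ, mul_comm]
    calc σ * σ ^ i = ∑ _w ∈ G.picked σ i u, σ ^ i := by simp [h1]
      _ ≤ _ := sum_le_sum fun w hw => by
        rw [picked, if_pos hs] at hw
        obtain ⟨ha, R, hR⟩ := exists_region_of_mem_pick hw
        rw [regionOf_regionsAt ha hR]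
        exact ih hR

/-- A vertex reaches its region through picked edges. -/
theorem edist_le_of_mem_region {H : SimpleGraph V} {i : ℕ} {u y : V} {R : Finset V}
    (h : G.region σ i u = some R) (hy : y ∈ R)
    (hH : ∀ x ∈ G.hopBall i u, ∀ j < i, ∀ w ∈ G.picked σ j x, H.Adj x w) : H.edist u y ≤ i := by
  classical
  induction i generalizing u R with
  | zero =>
    cases h
    rw [mem_singleton.1 hy]
    simp
  | succ i ih =>
    obtain ⟨hs, -, -, rfl⟩ := region_succ_eq_some h
    obtain ⟨w, hw, hy⟩ := mem_biUnion.1 hy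
    have hw' := hw
    rw [picked, if_pos hs] at hw'
    obtain ⟨ha, R, hR⟩ := exists_region_of_mem_pick hw'
    rw [regionOf_regionsAt ha hR] at hy
    refine (SimpleGraph.edist_triangle (v := w)).trans ?_
    push_cast
    rw [add_comm]
    refine add_le_add (ih hR hy fun x hx j hj => hH x ?_ j (by omega)) ?_
    · rw [add_comm]
      exact mem_hopBall_add.2 ⟨w, mem_hopBall_one.2 (Or.inr ha), hx⟩
    · exact (edist_eq_one_iff_adj.2 (hH u (self_mem_hopBall _ _) i (by omega) w hw)).le

/-- In a step in which a vertex `u` becomes inactive, its edges to active vertices `v` are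
spanned. -/
theorem edist_le_of_region_succ_eq_none {H : SimpleGraph V} {i : ℕ} {u v : V}
    (huv : G.Adj u v) (hu : (G.region σ i u).isSome) (hv : (G.region σ i v).isSome)
    (h : G.region σ (i + 1) u = none)
    (hH : ∀ x, x ∈ G.hopBall (i + 1) u ∨ x ∈ G.hopBall (i + 1) v →
      ∀ j < i + 1, ∀ w ∈ G.picked σ j x, H.Adj x w) : H.edist u v ≤ 2 * i + 1 := by
  classical
  rw [region] at h
  split_ifs at h with h'
  simp only [not_and, not_not] at h'
  have hp : G.picked σ i u = pick σ (G.regionsAt (G.region σ i) u) := if_pos hu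
  have hex := h' hu v (by simpa [regionsAt, huv] using hv)
  rw [← hp] at hex
  have hadj : ∀ w ∈ G.picked σ i u, H.edist u w ≤ 1 := fun w hw =>
    (edist_eq_one_iff_adj.2 (hH u (Or.inl (self_mem_hopBall _ _)) i (by omega) w hw)).le
  rcases hex with hex | ⟨w, hw, hd⟩
  · exact (hadj v hex).trans le_add_self
  · have hw' := hw
    rw [hp] at hw'
    obtain ⟨ha, R, hR⟩ := exists_region_of_mem_pick hw'
    obtain ⟨R', hR'⟩ := Option.isSome_iff_exists.1 hv
    rw [regionOf_regionsAt ha hR, regionOf_regionsAt huv hR', not_disjoint_iff] at hd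
    obtain ⟨y, hy, hy'⟩ := hd
    have e1 : H.edist w y ≤ i := edist_le_of_mem_region hR hy fun x hx j hj =>
      hH x (Or.inl (by
        rw [add_comm]
        exact mem_hopBall_add.2 ⟨w, mem_hopBall_one.2 (Or.inr ha), hx⟩)) j (by omega)
    have e2 : H.edist v y ≤ i := edist_le_of_mem_region hR' hy' fun x hx j hj =>
      hH x (Or.inr (hopBall_mono (Nat.le_succ i) _ hx)) j (by omega)
    calc H.edist u v ≤ H.edist u w + H.edist w v := SimpleGraph.edist_triangle
      _ ≤ 1 + (H.edist w y + H.edist y v) :=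
          add_le_add (hadj w hw) SimpleGraph.edist_triangle
      _ ≤ 1 + (i + i) := by
          rw [SimpleGraph.edist_comm (u := y)]
          gcongr
      _ = _ := by ring

/-- If `σ ^ k` exceeds the number of vertices, then nobody stays active for `k` steps, and so the
edges picked around `u` span the edges at `u`. -/
theorem edist_le_of_forall_picked {H : SimpleGraph V} {k : ℕ} {u v : V}
    (hk : Fintype.card V < σ ^ k) (huv : G.Adj u v)
    (hH : ∀ x ∈ G.hopBall (k + 1) u, ∀ j < k, ∀ w ∈ G.picked σ j x, H.Adj x w) :
    H.edist u v ≤ 2 * k := by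
  have hball : ∀ i ≤ k, ∀ x, x ∈ G.hopBall i u ∨ x ∈ G.hopBall i v → x ∈ G.hopBall (k + 1) u := by
    rintro i hi x (hx | hx)
    · exact hopBall_mono (by omega) _ hx
    · rw [add_comm]
      exact mem_hopBall_add.2
        ⟨v, mem_hopBall_one.2 (Or.inr huv), hopBall_mono hi _ hx⟩
  have key : ∀ i ≤ k, (G.region σ i u).isSome ∧ (G.region σ i v).isSome ∨
      H.edist u v ≤ 2 * k := by
    intro i
    induction i with
    | zero => exact fun _ => Or.inl ⟨rfl, rfl⟩
    | succ i ih =>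
      intro hi
      rcases ih (by omega) with ⟨h1, h2⟩ | h
      swap
      · exact Or.inr h
      have hle : (2 * i + 1 : ℕ∞) ≤ 2 * k := by
        have : 2 * i + 1 ≤ 2 * k := by omega
        exact_mod_cast this
      by_cases h3 : (G.region σ (i + 1) u).isSome
      · by_cases h4 : (G.region σ (i + 1) v).isSome
        · exact Or.inl ⟨h3, h4⟩
        · right
          rw [SimpleGraph.edist_comm]
          exact (edist_le_of_region_succ_eq_none huv.symm h2 h1 (by simpa using h4)
            fun x hx j hj => hH x (hball _ hi x hx.symm) j (by omega)).trans hle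
      · right
        exact (edist_le_of_region_succ_eq_none huv h1 h2 (by simpa using h3)
          fun x hx j hj => hH x (hball _ hi x hx) j (by omega)).trans hle
  rcases key k le_rfl with ⟨h, -⟩ | h
  · obtain ⟨R, hR⟩ := Option.isSome_iff_exists.1 h
    have := (pow_le_card_region hR).trans (card_le_univ R)
    omega
  · exact h

/-- The region of `u` depends on the edges around `u` only. -/
theorem region_congr {G' : SimpleGraph V} {i : ℕ} {u : V}
    (h : ∀ x ∈ G.hopBall i u, ∀ y, G'.Adj x y ↔ G.Adj x y) :
    G'.region σ i u = G.region σ i u := by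
  induction i generalizing u with
  | zero => rfl
  | succ i ih =>
    have h1 : G'.region σ i u = G.region σ i u :=
      ih fun x hx => h x (hopBall_mono (Nat.le_succ i) _ hx)
    have h2 : G'.regionsAt (G'.region σ i) u = G.regionsAt (G.region σ i) u := by
      funext w
      have hw := h u (self_mem_hopBall _ _) w
      by_cases huw : G.Adj u w
      · simp only [regionsAt, huw, hw.2 huw, if_true]
        refine ih fun x hx => h x ?_
        rw [add_comm]
        exact mem_hopBall_add.2 ⟨w, mem_hopBall_one.2 (Or.inr huw), hx⟩
      · simp only [regionsAt, huw, mt hw.1 huw, if_false]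
    rw [region, region, h1, h2]

theorem picked_congr {G' : SimpleGraph V} {i : ℕ} {u : V}
    (h : ∀ x ∈ G.hopBall (i + 1) u, ∀ y, G'.Adj x y ↔ G.Adj x y) :
    G'.picked σ i u = G.picked σ i u := by
  have h1 : G'.region σ i u = G.region σ i u :=
    region_congr fun x hx => h x (hopBall_mono (Nat.le_succ i) _ hx)
  have h2 : G'.regionsAt (G'.region σ i) u = G.regionsAt (G.region σ i) u := by
    funext w
    have hw := h u (self_mem_hopBall _ _) w
    by_cases huw : G.Adj u w
    · simp only [regionsAt, huw, hw.2 huw, if_true]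
      refine region_congr fun x hx => h x ?_
      rw [add_comm]
      exact mem_hopBall_add.2 ⟨w, mem_hopBall_one.2 (Or.inr huw), hx⟩
    · simp only [regionsAt, huw, mt hw.1 huw, if_false]
  rw [picked, picked, h1, h2]

end SimpleGraph

/-! ### Collecting balls by doubling the radius -/

namespace CongestedClique

open Finset SimpleGraph

variable {n : ℕ}

/-- What a vertex `v` knows while the balls are being collected. The set `D` consists of the edges
at the vertices of a ball around `v`. A vertex is `alive` as long as `D` is small. Otherwise it is
a `root`, with more than the permitted number of edges in its ball; or it is linked to a vertex `x`
of its ball that is no longer alive, and inherits its leader. The number is a radius within which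
the ball of a root is large, or within which `x` lies. -/
inductive Status (n : ℕ) : Type
  | alive (D : Finset (Fin n × Fin n))
  | root (D : Finset (Fin n × Fin n)) (R : ℕ)
  | link (D : Finset (Fin n × Fin n)) (R : ℕ) (x leader : Fin n)

namespace Status

/-- The set of edges known. -/
def darts : Status n → Finset (Fin n × Fin n)
  | alive D => D
  | root D _ => D
  | link D _ _ _ => D

/-- The root to which a vertex `v` that is no longer alive belongs. -/
def leader (v : Fin n) : Status n → Option (Fin n)
  | alive _ => none
  | root _ _ => some v
  | link _ _ _ r => some r

/-- A vertex stays alive if it has found at most `M` edges. -/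
def classify (M R : ℕ) (D : Finset (Fin n × Fin n)) : Status n :=
  if #D ≤ M then alive D else root D R

open Classical in
/-- The next status of a vertex `v`, where `L` and `P` are the leaders and the known edges of the
other vertices. -/
noncomputable def next (M i : ℕ) (v : Fin n) (L : Fin n → Option (Fin n))
    (P : Fin n → Finset (Fin n × Fin n)) : Status n → Status n
  | alive D =>
    if h : ∃ y : Fin n × Fin n, y.1 ∈ (ofDarts D).hopBall (2 ^ i) v ∧ L y.1 = some y.2 then
      link D (2 ^ i) h.choose.1 h.choose.2
    else classify M (2 ^ (i + 1)) (((ofDarts D).hopBall (2 ^ i) v).biUnion P)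
  | root D R => root D R
  | link D R x r => link D R x r

theorem leader_eq_none {v : Fin n} {s : Status n} : s.leader v = none ↔ ∃ D, s = alive D := by
  cases s <;> simp [leader]

theorem next_of_leader {M i : ℕ} {v r : Fin n} {L : Fin n → Option (Fin n)}
    {P : Fin n → Finset (Fin n × Fin n)} {s : Status n} (h : s.leader v = some r) :
    s.next M i v L P = s := by
  cases s
  · simp [leader] at h
  · rfl
  · rfl

end Status

open Status

/-- The status of a vertex after `i` doublings of the radius. An alive vertex then knows its ball
of radius `2 ^ i - 1` and the edges at it. -/
noncomputable def status (G : SimpleGraph (Fin n)) (M : ℕ) : ℕ → Fin n → Status n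
  | 0, v => classify M (2 ^ 0) (G.ballDarts 0 v)
  | i + 1, v => (status G M i v).next M i v (fun x => (status G M i x).leader x)
      fun x => (status G M i x).darts

variable {G : SimpleGraph (Fin n)} {M : ℕ}

/-- The meaning of the status of `v` after `i` doublings. -/
def StatusSpec (G : SimpleGraph (Fin n)) (M i : ℕ) (v : Fin n) : Status n → Prop
  | .alive D => D = G.ballDarts (2 ^ i - 1) v ∧ #D ≤ M
  | .root D R => ∃ j ≤ i, R = 2 ^ j ∧ D = G.ballDarts (2 ^ j - 1) v ∧ M < #D
  | .link D R x r => ∃ j < i, R = 2 ^ j ∧ D = G.ballDarts (2 ^ j - 1) v ∧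
      x ∈ G.hopBall (2 ^ j) v ∧ (status G M j x).leader x = some r

theorem hopBall_ofDarts (j : ℕ) (v : Fin n) :
    (ofDarts (G.ballDarts (2 ^ j - 1) v)).hopBall (2 ^ j) v = G.hopBall (2 ^ j) v :=
  hopBall_ofDarts_ballDarts (by have := Nat.one_le_two_pow (n := j); omega) v

theorem statusSpec_classify (i : ℕ) (v : Fin n) :
    StatusSpec G M i v (classify M (2 ^ i) (G.ballDarts (2 ^ i - 1) v)) := by
  unfold classify
  split_ifs with h
  · exact ⟨rfl, h⟩
  · exact ⟨i, le_rfl, rfl, rfl, not_le.1 h⟩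

theorem statusSpec_status (i : ℕ) (v : Fin n) : StatusSpec G M i v (status G M i v) := by
  classical
  induction i generalizing v with
  | zero => exact statusSpec_classify 0 v
  | succ i ih =>
    rw [status]
    have hv := ih v
    generalize status G M i v = s at hv
    cases s with
    | root D R =>
      obtain ⟨j, hj, h⟩ := hv
      exact ⟨j, by omega, h⟩
    | link D R x r =>
      obtain ⟨j, hj, h⟩ := hv
      exact ⟨j, by omega, h⟩
    | alive D =>
      obtain ⟨rfl, hD⟩ := hv
      rw [next, hopBall_ofDarts]
      split_ifs with h
      · exact ⟨i, by omega, rfl, rfl, h.choose_spec.1, h.choose_spec.2⟩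
      · have : (G.hopBall (2 ^ i) v).biUnion (fun x => (status G M i x).darts) =
            G.ballDarts (2 ^ (i + 1) - 1) v := by
          have h2 : 2 ^ (i + 1) - 1 = 2 ^ i + (2 ^ i - 1) := by
            have := Nat.one_le_two_pow (n := i)
            rw [pow_succ]
            omega
          rw [h2, ballDarts_add]
          refine biUnion_congr rfl fun x hx => ?_
          have hx' : (status G M i x).leader x = none := by
            by_contra hne
            obtain ⟨r, hr⟩ := Option.ne_none_iff_exists'.1 hne
            exact h ⟨(x, r), hx, hr⟩
          obtain ⟨D, hD⟩ := leader_eq_none.1 hx'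
          have := ih x
          rw [hD] at this ⊢
          exact this.1
        rw [this]
        exact statusSpec_classify (i + 1) v

theorem status_of_leader {i j : ℕ} {v r : Fin n} (hij : i ≤ j)
    (h : (status G M i v).leader v = some r) : status G M j v = status G M i v := by
  induction j, hij using Nat.le_induction with
  | base => rfl
  | succ j _ ih => rw [status, ih, next_of_leader h]

/-- The ball of a vertex that stays alive consists of vertices that were alive before. -/
theorem exists_alive_of_mem_hopBall {i : ℕ} {v x : Fin n} {D : Finset (Fin n × Fin n)}
    (h : status G M (i + 1) v = .alive D) (hx : x ∈ G.hopBall (2 ^ i) v) :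
    status G M i x = .alive (G.ballDarts (2 ^ i - 1) x) := by
  have hsx := statusSpec_status (G := G) (M := M) i x
  suffices (status G M i x).leader x = none by
    obtain ⟨D, hD⟩ := leader_eq_none.1 this
    rw [hD] at hsx ⊢
    rw [hsx.1]
  rw [status] at h
  have hv := statusSpec_status (G := G) (M := M) i v
  generalize status G M i v = s at hv h
  cases s with
  | root D R => cases h
  | link D R x r => cases h
  | alive D =>
    obtain ⟨rfl, hD⟩ := hv
    rw [next, hopBall_ofDarts] at h
    split_ifs at h with h'
    by_contra hne
    obtain ⟨r, hr⟩ := Option.ne_none_iff_exists'.1 hne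
    exact h' ⟨(x, r), hx, hr⟩

theorem Known.status_zero (B M : ℕ) : Known B 0 (fun (G : SimpleGraph (Fin n)) v =>
    (G.neighborSet v, status G M 0 v)) := by
  classical
  have h := (Known.neighborSet (n := n) (B := B)).map fun v N =>
    (N, classify M (2 ^ 0) ({e | e.1 = v ∧ e.2 ∈ N} : Finset (Fin n × Fin n)))
  convert h using 3 with G v
  rw [status]
  congr 2
  ext ⟨x, y⟩
  simp only [mem_ballDarts, mem_hopBall_zero, mem_filter, mem_univ, true_and, mem_neighborSet]
  constructor
  · rintro ⟨rfl, h⟩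
    exact ⟨rfl, h⟩
  · rintro ⟨rfl, h⟩
    exact ⟨rfl, h⟩

/-- One doubling of the radius takes four rounds: the vertices announce whether they are still
alive, and then each one sends its known edges to the vertices of its ball. The alive vertices lie
in few balls because this relation is symmetric. -/
theorem Known.status_succ {κ : Type} {B r i : ℕ} {c : SimpleGraph (Fin n) → Fin n → κ}
    (hM : (M + 1) * ((M + 1) * M) ≤ n) (h₁ : Fits B (Option (Fin n))) (h₂ : Fits B (Fin (M + 1)))
    (h₃ : Fits B (Option (Fin n × Option (Fin n × Fin n))))
    (h₄ : Fits B (Option (Option (Fin n × Fin n))))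
    (h : Known B r (fun G v => (c G v, status G M i v))) :
    Known B (r + 4) (fun G v => (c G v, status G M (i + 1) v)) := by
  classical
  have k₁ := h.comm h₁ fun v x _ => x.2.leader v
  let S : Fin n → ((κ × Status n) × (Fin n → Option (Fin n))) → Finset (Fin n) := fun v x =>
    match x.1.2 with
    | .alive D => ((ofDarts D).hopBall (2 ^ i) v).filter fun u => x.2 u = none
    | _ => ∅
  let P : Fin n → ((κ × Status n) × (Fin n → Option (Fin n))) → Fin M →
      Option (Fin n × Fin n) := fun _ x j => x.1.2.darts.toList[(j : ℕ)]?
  have hSv : ∀ (G : SimpleGraph (Fin n)) (u v : Fin n),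
      u ∈ S v ((c G v, status G M i v), fun u => (status G M i u).leader u) ↔
        (status G M i v).leader v = none ∧ (status G M i u).leader u = none ∧
          u ∈ G.hopBall (2 ^ i) v := by
    intro G u v
    have hv := statusSpec_status (G := G) (M := M) i v
    simp only [S]
    generalize status G M i v = s at hv
    cases s with
    | root D R => simp [leader]
    | link D R x r => simp [leader]
    | alive D =>
      obtain ⟨rfl, -⟩ := hv
      dsimp only
      rw [hopBall_ofDarts, mem_filter]
      simp only [leader, true_and]
      exact and_comm
  have k₂ := k₁.multicast hM (Nat.succ_pos M) S P
    (fun G u v hu => by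
      rw [hSv] at hu ⊢
      exact ⟨hu.2.1, hu.1, mem_hopBall_comm.1 hu.2.2⟩)
    (fun G v => by
      have hle : ∀ D, status G M i v = .alive D → #(G.hopBall (2 ^ i) v) ≤ M + 1 := by
        intro D hD
        have hv := statusSpec_status (G := G) (M := M) i v
        rw [hD] at hv
        have := card_hopBall_succ_le (G := G) (2 ^ i - 1) v
        rw [Nat.sub_add_cancel Nat.one_le_two_pow, ← hv.1] at this
        have := hv.2
        omega
      rcases (S v _).eq_empty_or_nonempty with h0 | ⟨u, hu⟩
      · rw [h0]; simp
      · obtain ⟨D, hD⟩ := leader_eq_none.1 ((hSv _ _ _).1 hu).1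
        exact (card_le_card fun u hu => ((hSv _ _ _).1 hu).2.2).trans (hle D hD))
    h₂ h₃ h₄
  have k₃ := k₂.map fun v x => (x.1.1.1, x.1.1.2.next M i v x.1.2 fun u =>
    match x.2 u with
    | some p => ({e | ∃ j, p j = some e} : Finset (Fin n × Fin n))
    | none => ∅)
  convert k₃ using 3 with G v
  refine Prod.ext rfl ?_
  change status G M (i + 1) v = _
  rw [status]
  have hv := statusSpec_status (G := G) (M := M) i v
  have hSv' := hSv G
  simp only [S] at hSv' ⊢
  generalize hs : status G M i v = s at hv
  cases s with
  | root D R => rfl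
  | link D R x r => rfl
  | alive D =>
    obtain ⟨rfl, -⟩ := hv
    rw [next, next]
    simp only [hopBall_ofDarts]
    split_ifs with hex
    · rfl
    congr 1
    refine biUnion_congr rfl fun u hu => ?_
    have hu' : (status G M i u).leader u = none := by
      by_contra hne
      obtain ⟨r, hr⟩ := Option.ne_none_iff_exists'.1 hne
      exact hex ⟨(u, r), hu, hr⟩
    rw [if_pos (mem_filter.2 ⟨hu, hu'⟩)]
    obtain ⟨D, hD⟩ := leader_eq_none.1 hu'
    have hsu := statusSpec_status (G := G) (M := M) i u
    rw [hD] at hsu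
    ext e
    simp only [P, hD, darts, mem_filter, mem_univ, true_and]
    rw [← mem_toList, List.mem_iff_getElem?]
    constructor
    · rintro ⟨j, hj⟩
      have hjlt := (List.getElem?_eq_some_iff.1 hj).1
      rw [length_toList] at hjlt
      exact ⟨⟨j, hjlt.trans_le hsu.2⟩, hj⟩
    · rintro ⟨j, hj⟩
      exact ⟨j, hj⟩

/-- A path within the graph with the edges `D`, as the successors of its vertices. -/
noncomputable def successor (D : Finset (Fin n × Fin n)) (R : ℕ) (v z : Fin n) :
    Fin n → Option (Fin n) :=
  open Classical in
  if h : z ∈ (ofDarts D).hopBall R v then (exists_successor h).choose else fun _ => none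

theorem adj_of_successor {D : Finset (Fin n × Fin n)} {R : ℕ} {v z x y : Fin n}
    (h : successor D R v z x = some y) : (ofDarts D).Adj x y := by
  unfold successor at h
  split_ifs at h with hz
  exact (exists_successor hz).choose_spec.1 x y h

theorem card_successor_le (D : Finset (Fin n × Fin n)) (R : ℕ) (v z : Fin n) :
    #{x | (successor D R v z x).isSome} ≤ R := by
  unfold successor
  split_ifs with hz
  · convert (exists_successor hz).choose_spec.2.1
  · simp

theorem edist_le_of_successor {D : Finset (Fin n × Fin n)} {R : ℕ} {v z : Fin n}
    {H : SimpleGraph (Fin n)} (hz : z ∈ (ofDarts D).hopBall R v)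
    (h : ∀ x y, successor D R v z x = some y → H.Adj x y) : H.edist v z ≤ R := by
  unfold successor at h
  rw [dif_pos hz] at h
  exact (exists_successor hz).choose_spec.2.2 H h

end CongestedClique

/-! ### The spanner inside small balls, and clusters around the large ones -/

namespace CongestedClique

open Finset SimpleGraph

variable {n : ℕ}

open Classical in
/-- For a root `v`, a set of `d` vertices of its large ball. -/
noncomputable def rootSet (d : ℕ) (v : Fin n) : Status n → Finset (Fin n)
  | .root D R => if h : ∃ W ⊆ (ofDarts D).hopBall R v, #W = d then h.choose else ∅
  | _ => ∅

open Classical in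
/-- The centre that a root `v` chooses, given a set `T` of sampled vertices: a sampled vertex of its
ball, or `v` itself if there is none. -/
noncomputable def center (d : ℕ) (T : Finset (Fin n)) (v : Fin n) (s : Status n) : Fin n :=
  if h : ∃ z, z ∈ rootSet d v s ∧ z ∈ T then h.choose else v

/-- The path that a vertex which is not alive adds to the spanner: a root is joined to its centre,
and a linked vertex to the vertex that it is linked to. -/
noncomputable def linkPath (d : ℕ) (T : Finset (Fin n)) (v : Fin n) :
    Status n → Fin n → Option (Fin n)
  | .alive _ => fun _ => none
  | .root D R => successor D R v (center d T v (.root D R))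
  | .link D R x _ => successor D R v x

/-- All the neighbours that `v` picks in the local construction, computed from its ball. -/
noncomputable def localPicks (k σ : ℕ) (v : Fin n) : Status n → Finset (Fin n)
  | .alive D => (range k).biUnion fun j => (ofDarts D).picked σ j v
  | _ => ∅

variable {G : SimpleGraph (Fin n)} {M : ℕ}

theorem localPicks_status {k L : ℕ} (hk : k + 1 ≤ 2 ^ L) (σ : ℕ) (v : Fin n)
    {D : Finset (Fin n × Fin n)} (h : status G M L v = .alive D) :
    localPicks k σ v (status G M L v) = (range k).biUnion fun j => G.picked σ j v := by
  have hs := statusSpec_status (G := G) (M := M) L v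
  rw [h] at hs ⊢
  obtain ⟨rfl, -⟩ := hs
  refine biUnion_congr rfl fun j hj => picked_congr fun x hx y => ?_
  have := mem_range.1 hj
  exact ofDarts_ballDarts_adj (hopBall_mono (by omega) _ hx)

theorem adj_of_mem_localPicks {k σ L : ℕ} (hk : k + 1 ≤ 2 ^ L) {v y : Fin n}
    (hy : y ∈ localPicks k σ v (status G M L v)) : G.Adj v y := by
  generalize hs : status G M L v = s at hy
  cases s with
  | root D R => simp [localPicks] at hy
  | link D R x r => simp [localPicks] at hy
  | alive D =>
    rw [← hs, localPicks_status hk σ v hs, mem_biUnion] at hy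
    obtain ⟨j, -, hj⟩ := hy
    exact adj_of_mem_picked hj

theorem card_localPicks_le (k σ : ℕ) (v : Fin n) (s : Status n) :
    #(localPicks k σ v s) ≤ k * σ := by
  cases s with
  | root D R => simp [localPicks]
  | link D R x r => simp [localPicks]
  | alive D =>
    refine card_biUnion_le.trans ?_
    refine (sum_le_sum fun j _ => card_picked_le j v).trans ?_
    simp

theorem rootSet_spec {d j : ℕ} (hd : d ^ 2 ≤ M) {v : Fin n}
    (hM : M < #(G.ballDarts (2 ^ j - 1) v)) :
    rootSet d v (.root (G.ballDarts (2 ^ j - 1) v) (2 ^ j)) ⊆ G.hopBall (2 ^ j) v ∧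
      #(rootSet d v (.root (G.ballDarts (2 ^ j - 1) v) (2 ^ j))) = d := by
  have h : ∃ W ⊆ (ofDarts (G.ballDarts (2 ^ j - 1) v)).hopBall (2 ^ j) v, #W = d := by
    rw [hopBall_ofDarts]
    refine exists_subset_card_eq ?_
    have := card_ballDarts_le (G := G) (2 ^ j - 1) v
    rw [Nat.sub_add_cancel Nat.one_le_two_pow] at this
    exact le_of_lt (lt_of_pow_lt_pow_left₀ 2 (Nat.zero_le _) (hd.trans_lt (hM.trans_le this)))
  rw [rootSet, dif_pos h]
  exact ⟨h.choose_spec.1.trans (hopBall_ofDarts j v).subset, h.choose_spec.2⟩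

theorem center_mem {d j : ℕ} (hd : d ^ 2 ≤ M) (T : Finset (Fin n)) {v : Fin n}
    (hM : M < #(G.ballDarts (2 ^ j - 1) v)) :
    center d T v (.root (G.ballDarts (2 ^ j - 1) v) (2 ^ j)) ∈ G.hopBall (2 ^ j) v := by
  unfold center
  split_ifs with h
  · exact (rootSet_spec hd hM).1 h.choose_spec.1
  · exact self_mem_hopBall _ _

theorem adj_of_linkPath {d i : ℕ} {T : Finset (Fin n)} {v x y : Fin n}
    (h : linkPath d T v (status G M i v) x = some y) : G.Adj x y := by
  have hs := statusSpec_status (G := G) (M := M) i v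
  generalize status G M i v = s at hs h
  cases s with
  | alive D => simp [linkPath] at h
  | root D R =>
    obtain ⟨j, -, rfl, rfl, -⟩ := hs
    exact ofDarts_ballDarts_le _ _ (adj_of_successor h)
  | link D R x r =>
    obtain ⟨j, -, rfl, rfl, -⟩ := hs
    exact ofDarts_ballDarts_le _ _ (adj_of_successor h)

theorem card_linkPath_le (d i : ℕ) (T : Finset (Fin n)) (v : Fin n) :
    #{x | (linkPath d T v (status G M i v) x).isSome} ≤ 2 ^ i := by
  have hs := statusSpec_status (G := G) (M := M) i v
  generalize status G M i v = s at hs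
  cases s with
  | alive D => simp [linkPath]
  | root D R =>
    obtain ⟨j, hj, rfl, rfl, -⟩ := hs
    exact (card_successor_le _ _ _ _).trans (Nat.pow_le_pow_right (by norm_num) hj)
  | link D R x r =>
    obtain ⟨j, hj, rfl, rfl, -⟩ := hs
    exact (card_successor_le _ _ _ _).trans (Nat.pow_le_pow_right (by norm_num) hj.le)

/-- Following the links leads to the leader, which is a root, after at most `2 ^ i` steps: each link
goes to a vertex that ceased to be alive at half the radius or earlier. -/
theorem edist_leader_le {d i I : ℕ} (hi : i ≤ I) {T : Finset (Fin n)} {H : SimpleGraph (Fin n)}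
    (hH : ∀ v x y, linkPath d T v (status G M I v) x = some y → H.Adj x y) {v r : Fin n}
    (h : (status G M i v).leader v = some r) :
    H.edist v r ≤ (2 ^ i : ℕ) ∧ ∃ D R, status G M I r = .root D R := by
  induction i using Nat.strong_induction_on generalizing v with
  | _ i ih =>
    have hI := status_of_leader hi h
    have hs := statusSpec_status (G := G) (M := M) i v
    generalize hsv : status G M i v = s at hs h hI
    cases s with
    | alive D => simp [Status.leader] at h
    | root D R =>
      simp only [Status.leader, Option.some.injEq] at h
      subst h
      exact ⟨by simp, D, R, hI⟩
    | link D R x r' =>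
      simp only [Status.leader, Option.some.injEq] at h
      subst h
      obtain ⟨j, hj, rfl, rfl, hx, hl⟩ := hs
      obtain ⟨h1, h2⟩ := ih j hj (by omega) hl
      refine ⟨?_, h2⟩
      have h3 : H.edist v x ≤ (2 ^ j : ℕ) := by
        refine edist_le_of_successor (D := G.ballDarts (2 ^ j - 1) v) ?_ fun a b hab => hH v a b ?_
        · rwa [hopBall_ofDarts]
        · rw [hI]
          exact hab
      calc H.edist v r' ≤ H.edist v x + H.edist x r' := SimpleGraph.edist_triangle
        _ ≤ (2 ^ j : ℕ) + (2 ^ j : ℕ) := add_le_add h3 h1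
        _ ≤ (2 ^ i : ℕ) := by
          have : 2 ^ (j + 1) ≤ 2 ^ i := Nat.pow_le_pow_right (by norm_num) hj
          rw [pow_succ] at this
          have : 2 ^ j + 2 ^ j ≤ 2 ^ i := by omega
          exact_mod_cast this

theorem Known.status {B : ℕ} (hn : 2 ≤ n) (hB : B = 5 * Nat.clog 2 n)
    (hM : (M + 1) * ((M + 1) * M) ≤ n) {κ : Type} {c : SimpleGraph (Fin n) → Fin n → κ} {r i : ℕ}
    (h : Known B r (fun G v => (c G v, status G M i v))) (j : ℕ) :
    Known B (r + 4 * j) (fun G v => (c G v, CongestedClique.status G M (i + j) v)) := by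
  subst hB
  induction j with
  | zero => exact h
  | succ j ih =>
    refine ih.status_succ hM (fits_node hn) (fits_fin hn (Nat.succ_pos M) ?_) (fits_word hn)
      (fits_pair hn)
    by_contra hlt
    have : 1 * (1 * M) ≤ (M + 1) * ((M + 1) * M) := by gcongr <;> omega
    omega

/-- The centres of the clusters, where `ℓ v` is the centre of the cluster of `v`, if any. -/
def centers (ℓ : Fin n → Option (Fin n)) : Finset (Fin n) := {a | ∃ v, ℓ v = some a}

theorem mem_centers {ℓ : Fin n → Option (Fin n)} {a : Fin n} :
    a ∈ centers ℓ ↔ ∃ v, ℓ v = some a := by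
  simp [centers]

/-- The vertices with small balls choose edges of a spanner on their own. All other vertices are
grouped into few clusters of radius `O(2 ^ L)`, where `O G v` is the set of the neighbours that `v`
wants to be joined to and `ℓ G v` is the centre of the cluster of `v`. -/
theorem exists_ball_clustering {k σ L d e g : ℕ} (hn : 2 ≤ n)
    (hM : (M + 1) * ((M + 1) * M) ≤ n) (hd : d ^ 2 ≤ M) {Zs : Fin n → Finset (Fin n)}
    (hZs : IsHittingFamily e d g Zs) (hσ : n < σ ^ k) (hk : k + 1 ≤ 2 ^ L) :
    ∃ (O : SimpleGraph (Fin n) → Fin n → Finset (Fin n))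
      (ℓ : SimpleGraph (Fin n) → Fin n → Option (Fin n)),
      Known (5 * Nat.clog 2 n) (4 * (L + 1) + 5) (fun G v => (G.neighborSet v, O G v, ℓ G)) ∧
      ∀ G, (∀ u, ∀ v ∈ O G u, G.Adj u v) ∧
        ∑ v, #(O G v) ≤ n * (k * σ + 2 ^ (L + 1)) ∧
        e * #(centers (ℓ G)) ≤ (2 + g) * n ∧
        ∀ H : SimpleGraph (Fin n), (∀ u, ∀ v ∈ O G u, H.Adj u v) →
          (∀ v a, ℓ G v = some a → H.edist v a ≤ (2 ^ (L + 2) : ℕ)) ∧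
          ∀ u v, G.Adj u v → H.edist u v ≤ 2 * k ∨ (ℓ G u).isSome ∧ (ℓ G v).isSome := by
  classical
  set B := 5 * Nat.clog 2 n with hB
  have k₁ := (Known.status_zero (n := n) B M).status hn hB hM L
  rw [zero_add, zero_add] at k₁
  have k₂ := (k₁.map fun _ x => (x, x.2)).status hn hB hM 1
  obtain ⟨w, k₃, hwc, hw⟩ := k₂.hittingSet (fits_bool hn) (fits_fin hn (by omega) le_rfl) hZs
    (fun _ _ => True) (fun _ x => ∃ D R, x.2 = .root D R) fun v x => rootSet d v x.2
  have k₄ := k₃.comm (fits_node hn) fun v x _ => some (center d (Zs x.2) v x.1.2)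
  have k₅ := k₄.comm (fits_node hn) fun v x _ => (x.1.1.2.leader v).bind x.2
  have k₆ := k₅.comm (fits_node hn) fun v x y => linkPath d (Zs x.1.1.2) v x.1.1.1.2 y
  have k₇ := k₆.map fun v x => (x.1.1.1.1.1.1,
    localPicks k σ v x.1.1.1.1.1.2 ∪ ({y | ∃ u, x.2 u = some y} : Finset (Fin n)), x.1.2)
  have e1 : 4 * L + 4 * 1 + 2 + 1 + 1 + 1 = 4 * (L + 1) + 5 := by ring
  rw [e1] at k₇
  refine ⟨_, _, k₇, fun G => ?_⟩
  have v₀ : Fin n := ⟨0, by omega⟩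
  set T := Zs (w G v₀) with hT
  have hwT : ∀ v, Zs (w G v) = T := fun v => by rw [hT, hwc G v v₀]
  simp only [hwT]
  have hlabel : ∀ v a, ((status G M (L + 1) v).leader v).bind
      (fun u => some (center d T u (status G M (L + 1) u))) = some a →
      ∃ r, (status G M (L + 1) v).leader v = some r ∧
        center d T r (status G M (L + 1) r) = a := by
    intro v a h
    obtain ⟨r, hr, hra⟩ := Option.bind_eq_some_iff.1 h
    exact ⟨r, hr, Option.some.inj hra⟩
  refine ⟨?_, ?_, ?_, fun H hH => ?_⟩
  · intro u v hv
    rcases mem_union.1 hv with hv | hv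
    · exact adj_of_mem_localPicks hk hv
    · obtain ⟨x, hx⟩ := (mem_filter.1 hv).2
      exact adj_of_linkPath hx
  · calc _ ≤ ∑ v, (k * σ + ∑ u, if (linkPath d T u (status G M (L + 1) u) v).isSome
            then 1 else 0) := by
          refine sum_le_sum fun v _ => (card_union_le _ _).trans
            (add_le_add (card_localPicks_le _ _ _ _) ?_)
          rw [← card_filter]
          refine (card_le_card (t := ((univ.filter fun u => (linkPath d T u
            (status G M (L + 1) u) v).isSome).image
              fun u => (linkPath d T u (status G M (L + 1) u) v).getD v)) ?_).trans card_image_le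
          intro y hy
          obtain ⟨u, hu⟩ := (mem_filter.1 hy).2
          refine mem_image.2 ⟨u, mem_filter.2 ⟨mem_univ _, ?_⟩, ?_⟩
          · rw [hu]; rfl
          · rw [hu]; rfl
      _ = n * (k * σ) + ∑ u, #{v | (linkPath d T u (status G M (L + 1) u) v).isSome} := by
          rw [sum_add_distrib, sum_comm]
          simp
      _ ≤ n * (k * σ) + ∑ _u : Fin n, 2 ^ (L + 1) := by
          gcongr
          exact card_linkPath_le _ _ _ _
      _ = _ := by
          simp
          ring
  · set I : Finset (Fin n) := {u | ∃ D R, status G M (L + 1) u = .root D R} with hI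
    have hmem : ∀ u, u ∈ I ↔ ∃ D R, status G M (L + 1) u = .root D R := fun u => by simp [hI]
    have hb := hw G v₀ univ I (by simp) hmem (by
      intro u hu
      obtain ⟨D, R, hu⟩ := (hmem u).1 hu
      have hs := statusSpec_status (G := G) (M := M) (L + 1) u
      dsimp only
      rw [hu] at hs ⊢
      obtain ⟨j, -, rfl, rfl, hlt⟩ := hs
      exact (rootSet_spec hd hlt).2)
    rw [← hT] at hb
    refine (Nat.mul_le_mul_left e ?_).trans (hb.trans ?_)
    · rw [univ_inter]
      refine (card_le_card fun a ha => ?_).trans (card_union_le _ _)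
      obtain ⟨v, hv⟩ := mem_centers.1 ha
      obtain ⟨r, hr, rfl⟩ := hlabel v a hv
      obtain ⟨-, hroot⟩ := edist_leader_le (d := d) (T := T) (H := G) le_rfl
        (fun v x y h => adj_of_linkPath h) hr
      rw [mem_union]
      unfold center
      split_ifs with h
      · exact Or.inl h.choose_spec.2
      · refine Or.inr (mem_filter.2 ⟨(hmem r).2 hroot, ?_⟩)
        rw [Finset.disjoint_left]
        exact fun z hz hz' => h ⟨z, hz, hz'⟩
    · have h2 := card_le_univ I
      rw [card_univ]
      rw [Fintype.card_fin] at h2 ⊢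
      calc _ ≤ n + (1 + g) * n := by gcongr
        _ = _ := by ring
  · have hpath : ∀ v x y, linkPath d T v (status G M (L + 1) v) x = some y → H.Adj x y :=
      fun v x y h => hH x y (mem_union_right _ (mem_filter.2 ⟨mem_univ _, v, h⟩))
    refine ⟨?_, ?_⟩
    · intro v a hv
      obtain ⟨r, hr, rfl⟩ := hlabel v a hv
      obtain ⟨h1, D, R, hroot⟩ := edist_leader_le le_rfl hpath hr
      have hs := statusSpec_status (G := G) (M := M) (L + 1) r
      have hp := hpath r
      rw [hroot] at hs hp ⊢
      obtain ⟨j, hj, rfl, rfl, hlt⟩ := hs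
      have h2 : H.edist r (center d T r (.root (G.ballDarts (2 ^ j - 1) r) (2 ^ j))) ≤
          (2 ^ j : ℕ) := by
        refine edist_le_of_successor (D := G.ballDarts (2 ^ j - 1) r) ?_ hp
        rw [hopBall_ofDarts]
        exact center_mem hd T hlt
      have h3 : 2 ^ j ≤ 2 ^ (L + 1) := Nat.pow_le_pow_right (by norm_num) hj
      have h4 : 2 ^ (L + 1) + 2 ^ j ≤ 2 ^ (L + 2) := by
        rw [pow_succ 2 (L + 1)]
        omega
      refine SimpleGraph.edist_triangle.trans ((add_le_add h1 h2).trans ?_)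
      exact_mod_cast h4
    · -- If an endpoint of an edge stays alive, then every vertex around it knows its own ball and
      -- has picked its edges.
      have halive : ∀ u v, G.Adj u v → (status G M (L + 1) u).leader u = none →
          H.edist u v ≤ 2 * k := by
        intro u v huv hu
        obtain ⟨D, hD⟩ := Status.leader_eq_none.1 hu
        refine edist_le_of_forall_picked (σ := σ) (by simpa using hσ) huv fun x hx j hj y hy => ?_
        have hx' := exists_alive_of_mem_hopBall hD (hopBall_mono hk _ hx)
        refine hH x y (mem_union_left _ ?_)
        rw [localPicks_status hk σ x hx']
        exact mem_biUnion.2 ⟨j, mem_range.2 hj, hy⟩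
      intro u v huv
      by_cases hu : (status G M (L + 1) u).leader u = none
      · exact Or.inl (halive u v huv hu)
      by_cases hv : (status G M (L + 1) v).leader v = none
      · left
        rw [SimpleGraph.edist_comm]
        exact halive v u huv.symm hv
      · right
        obtain ⟨a, ha⟩ := Option.ne_none_iff_exists'.1 hu
        obtain ⟨b, hb⟩ := Option.ne_none_iff_exists'.1 hv
        simp [ha, hb]

end CongestedClique

/-! ### Merging clusters -/

namespace CongestedClique

open Finset SimpleGraph

variable {n : ℕ}

open Classical in
/-- A neighbour of `x` in the cluster with the centre `b`, if `x` is in another cluster; the set of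
the neighbours of `x` is `N`. -/
noncomputable def contact (N : Set (Fin n)) (ℓ : Fin n → Option (Fin n)) (x b : Fin n) :
    Option (Fin n) :=
  if h : ∃ y ∈ N, ℓ y = some b ∧ (ℓ x).isSome ∧ ℓ x ≠ some b then some h.choose else none

section Local

variable (d : ℕ) (ℓ c : Fin n → Option (Fin n)) (T : Finset (Fin n))

/-- The adjacent clusters of a cluster, if `c x` is the contact of `x` in this cluster. -/
def adjClusters : Finset (Fin n) := {a | ∃ x, ℓ x = some a ∧ (c x).isSome}

open Classical in
/-- A vertex of the adjacent cluster with the centre `a` that has a contact. -/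
noncomputable def delegate (a : Fin n) : Fin n :=
  if h : ∃ x, ℓ x = some a ∧ (c x).isSome then h.choose else a

open Classical in
/-- A set of `d` adjacent clusters of a cluster that has so many. -/
noncomputable def adjSample : Finset (Fin n) :=
  if h : ∃ W ⊆ adjClusters ℓ c, #W = d then h.choose else ∅

open Classical in
/-- The sampled adjacent cluster that a cluster is merged into, if there is one. -/
noncomputable def host : Option (Fin n) :=
  if h : ∃ a, a ∈ adjSample d ℓ c ∧ a ∈ T then some h.choose else none

/-- The adjacent clusters to which the cluster adds an edge: all of them if there are fewer than
`d`, and otherwise only the one into which it is merged. -/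
noncomputable def joined : Finset (Fin n) :=
  if #(adjClusters ℓ c) < d then adjClusters ℓ c else (host d ℓ c T).toFinset

/-- The new centre for the vertices of the cluster with the centre `b`. A cluster with fewer than
`d` adjacent ones is dissolved. -/
noncomputable def newCenter (b : Fin n) : Option (Fin n) :=
  if #(adjClusters ℓ c) < d then none else some ((host d ℓ c T).getD b)

variable {d ℓ c T}

theorem mem_adjClusters {a : Fin n} : a ∈ adjClusters ℓ c ↔ ∃ x, ℓ x = some a ∧ (c x).isSome := by
  simp [adjClusters]

theorem delegate_spec {a : Fin n} (h : a ∈ adjClusters ℓ c) :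
    ℓ (delegate ℓ c a) = some a ∧ (c (delegate ℓ c a)).isSome := by
  have h' := mem_adjClusters.1 h
  rw [delegate, dif_pos h']
  exact h'.choose_spec

theorem adjClusters_subset : adjClusters ℓ c ⊆ centers ℓ := fun a ha => by
  obtain ⟨x, hx, -⟩ := mem_adjClusters.1 ha
  exact mem_centers.2 ⟨x, hx⟩

theorem adjSample_spec (h : d ≤ #(adjClusters ℓ c)) :
    adjSample d ℓ c ⊆ adjClusters ℓ c ∧ #(adjSample d ℓ c) = d := by
  have h' := exists_subset_card_eq h
  rw [adjSample, dif_pos h']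
  exact h'.choose_spec

theorem host_spec {a : Fin n} (h : host d ℓ c T = some a) :
    a ∈ adjSample d ℓ c ∧ a ∈ T := by
  unfold host at h
  split_ifs at h with h'
  rw [← Option.some.inj h]
  exact h'.choose_spec

theorem joined_subset : joined d ℓ c T ⊆ adjClusters ℓ c := by
  unfold joined
  split_ifs with h
  · exact subset_rfl
  · intro a ha
    exact (adjSample_spec (not_lt.1 h)).1 (host_spec (by simpa using ha)).1

theorem card_joined_le (hd : 0 < d) : #(joined d ℓ c T) ≤ min d #(centers ℓ) := by
  refine le_min ?_ (card_le_card (joined_subset.trans adjClusters_subset))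
  unfold joined
  split_ifs with h
  · exact h.le
  · refine le_trans ?_ (Nat.succ_le_of_lt hd)
    rw [Option.card_toFinset]
    cases host d ℓ c T <;> simp

theorem isSome_contact {N : Set (Fin n)} {x b : Fin n} :
    (contact N ℓ x b).isSome ↔ ∃ y ∈ N, ℓ y = some b ∧ (ℓ x).isSome ∧ ℓ x ≠ some b := by
  unfold contact
  split_ifs with h <;> simp [h]

theorem contact_spec {N : Set (Fin n)} {x y b : Fin n} (h : contact N ℓ x b = some y) :
    y ∈ N ∧ ℓ y = some b := by
  unfold contact at h
  split_ifs at h with h'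
  rw [← Option.some.inj h]
  exact ⟨h'.choose_spec.1, h'.choose_spec.2.1⟩

end Local

/-- The contacts of all vertices in the cluster with the centre `b`. -/
noncomputable def contactsIn (G : SimpleGraph (Fin n)) (ℓ : Fin n → Option (Fin n)) (b : Fin n) :
    Fin n → Option (Fin n) :=
  fun x => contact (G.neighborSet x) ℓ x b

open Classical in
/-- The vertices to which `x` is joined in one step of merging clusters. -/
noncomputable def mergeChoices (G : SimpleGraph (Fin n)) (d : ℕ) (ℓ : Fin n → Option (Fin n))
    (T : Finset (Fin n)) (x : Fin n) : Finset (Fin n) :=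
  {y | ∃ b, (∃ a ∈ joined d ℓ (contactsIn G ℓ b) T, delegate ℓ (contactsIn G ℓ b) a = x) ∧
    contact (G.neighborSet x) ℓ x b = some y}

/-- The new centres of the vertices after one step of merging clusters. -/
noncomputable def mergeCenter (G : SimpleGraph (Fin n)) (d : ℕ) (ℓ : Fin n → Option (Fin n))
    (T : Finset (Fin n)) (x : Fin n) : Option (Fin n) :=
  (ℓ x).bind fun b => newCenter d ℓ (contactsIn G ℓ b) T b

variable {G : SimpleGraph (Fin n)} {d : ℕ} {ℓ : Fin n → Option (Fin n)} {T : Finset (Fin n)}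

theorem adj_of_mem_mergeChoices {x y : Fin n} (h : y ∈ mergeChoices G d ℓ T x) : G.Adj x y := by
  classical
  obtain ⟨b, -, hb⟩ := (mem_filter.1 h).2
  exact (contact_spec hb).1

theorem sum_card_mergeChoices_le (hd : 0 < d) :
    ∑ x, #(mergeChoices G d ℓ T x) ≤ #(centers ℓ) * min d #(centers ℓ) := by
  classical
  let J : Fin n → Finset (Fin n) := fun b => joined d ℓ (contactsIn G ℓ b) T
  have hJ : ∀ b, b ∉ centers ℓ → J b = ∅ := by
    intro b hb
    refine Finset.eq_empty_of_forall_notMem fun a ha => hb ?_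
    obtain ⟨x, -, hx⟩ := mem_adjClusters.1 (joined_subset ha)
    obtain ⟨y, -, hy, -⟩ := isSome_contact.1 hx
    exact mem_centers.2 ⟨y, hy⟩
  calc ∑ x, #(mergeChoices G d ℓ T x)
      ≤ ∑ x, #{b | ∃ a ∈ J b, delegate ℓ (contactsIn G ℓ b) a = x} := by
        refine sum_le_sum fun x _ => ?_
        refine (card_le_card (t := image (fun b => (contact (G.neighborSet x) ℓ x b).getD x)
          {b | ∃ a ∈ J b, delegate ℓ (contactsIn G ℓ b) a = x}) fun y hy => ?_).trans
          card_image_le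
        obtain ⟨b, hb, hy⟩ := (mem_filter.1 hy).2
        exact mem_image.2 ⟨b, mem_filter.2 ⟨mem_univ _, hb⟩, by rw [hy]; rfl⟩
    _ = ∑ b, #{x | ∃ a ∈ J b, delegate ℓ (contactsIn G ℓ b) a = x} := by
        simp only [card_filter]
        rw [sum_comm]
    _ ≤ ∑ b, #(J b) := by
        refine sum_le_sum fun b _ => ?_
        refine (card_le_card (t := (J b).image (delegate ℓ (contactsIn G ℓ b)))
          fun x hx => ?_).trans card_image_le
        exact mem_image.2 (mem_filter.1 hx).2
    _ = ∑ b ∈ centers ℓ, #(J b) := by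
        refine (sum_subset (subset_univ _) fun b _ hb => ?_).symm
        rw [hJ b hb, card_empty]
    _ ≤ ∑ _b ∈ centers ℓ, min d #(centers ℓ) := sum_le_sum fun b _ => card_joined_le hd
    _ = _ := by simp

/-- The chosen edge between a cluster and an adjacent one that it joins. -/
theorem edist_le_of_mem_joined {H : SimpleGraph (Fin n)} {R : ℕ}
    (hH : ∀ u, ∀ v ∈ mergeChoices G d ℓ T u, H.Adj u v)
    (hR : ∀ v a, ℓ v = some a → H.edist v a ≤ R) {a b : Fin n}
    (h : a ∈ joined d ℓ (contactsIn G ℓ b) T) : H.edist b a ≤ 2 * R + 1 := by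
  classical
  obtain ⟨h1, h2⟩ := delegate_spec (joined_subset h)
  set x := delegate ℓ (contactsIn G ℓ b) a with hx
  obtain ⟨y, hy⟩ := Option.isSome_iff_exists.1 h2
  have hxy := hH x y (mem_filter.2 ⟨mem_univ _, b, ⟨a, h, hx.symm⟩, hy⟩)
  calc H.edist b a ≤ H.edist b y + H.edist y a := SimpleGraph.edist_triangle
    _ ≤ H.edist b y + (H.edist y x + H.edist x a) :=
        add_le_add le_rfl SimpleGraph.edist_triangle
    _ ≤ R + (1 + R) := by
        refine add_le_add ?_ (add_le_add ?_ (hR x a h1))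
        · rw [SimpleGraph.edist_comm]
          exact hR y b (contact_spec hy).2
        · exact (edist_eq_one_iff_adj.2 hxy.symm).le
    _ = _ := by ring

theorem edist_mergeCenter_le {H : SimpleGraph (Fin n)} {R : ℕ}
    (hH : ∀ u, ∀ v ∈ mergeChoices G d ℓ T u, H.Adj u v)
    (hR : ∀ v a, ℓ v = some a → H.edist v a ≤ R) {v a : Fin n}
    (h : mergeCenter G d ℓ T v = some a) : H.edist v a ≤ (3 * R + 1 : ℕ) := by
  obtain ⟨b, hb, h⟩ := Option.bind_eq_some_iff.1 h
  unfold newCenter at h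
  split_ifs at h with hlt
  have h := Option.some.inj h
  cases hh : host d ℓ (contactsIn G ℓ b) T with
  | none =>
    rw [hh] at h
    rw [← h]
    refine (hR v b hb).trans ?_
    exact_mod_cast (by omega : R ≤ 3 * R + 1)
  | some a' =>
    rw [hh, Option.getD_some] at h
    subst h
    have hj : a' ∈ joined d ℓ (contactsIn G ℓ b) T := by
      rw [joined, if_neg hlt, hh]
      simp
    calc H.edist v a' ≤ H.edist v b + H.edist b a' := SimpleGraph.edist_triangle
      _ ≤ R + (2 * R + 1) := add_le_add (hR v b hb) (edist_le_of_mem_joined hH hR hj)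
      _ = _ := by push_cast; ring

/-- The edges at a cluster that is dissolved are spanned. -/
theorem edist_le_or_isSome_mergeCenter {H : SimpleGraph (Fin n)} {R : ℕ}
    (hH : ∀ u, ∀ v ∈ mergeChoices G d ℓ T u, H.Adj u v)
    (hR : ∀ v a, ℓ v = some a → H.edist v a ≤ R) {u v : Fin n} (huv : G.Adj u v)
    (hu : (ℓ u).isSome) (hv : (ℓ v).isSome) :
    H.edist u v ≤ (4 * R + 1 : ℕ) ∨ (mergeCenter G d ℓ T u).isSome := by
  obtain ⟨b, hb⟩ := Option.isSome_iff_exists.1 hu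
  obtain ⟨a, ha⟩ := Option.isSome_iff_exists.1 hv
  by_cases hab : a = b
  · left
    subst hab
    calc H.edist u v ≤ H.edist u a + H.edist a v := SimpleGraph.edist_triangle
      _ ≤ R + R := add_le_add (hR u a hb) (by
        rw [SimpleGraph.edist_comm]; exact hR v a ha)
      _ ≤ _ := by exact_mod_cast (by omega : R + R ≤ 4 * R + 1)
  by_cases hlt : #(adjClusters ℓ (contactsIn G ℓ b)) < d
  · left
    have hmem : a ∈ joined d ℓ (contactsIn G ℓ b) T := by
      rw [joined, if_pos hlt, mem_adjClusters]
      exact ⟨v, ha, isSome_contact.2 ⟨u, huv.symm, hb, hv, fun h =>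
        hab (Option.some.inj (ha.symm.trans h))⟩⟩
    calc H.edist u v ≤ H.edist u b + H.edist b v := SimpleGraph.edist_triangle
      _ ≤ H.edist u b + (H.edist b a + H.edist a v) :=
        add_le_add le_rfl SimpleGraph.edist_triangle
      _ ≤ R + ((2 * R + 1) + R) := by
        refine add_le_add (hR u b hb) (add_le_add (edist_le_of_mem_joined hH hR hmem) ?_)
        rw [SimpleGraph.edist_comm]
        exact hR v a ha
      _ = _ := by push_cast; ring
  · right
    simp [mergeCenter, hb, newCenter, hlt]

theorem mergeCenter_eq_none (h : #(centers ℓ) < d) (v : Fin n) : mergeCenter G d ℓ T v = none := by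
  refine Option.bind_eq_none_iff.2 fun b _ => ?_
  rw [newCenter, if_pos ((card_le_card adjClusters_subset).trans_lt h)]

/-- One step of merging clusters takes five rounds. Its parameters are the threshold `d` for the
number of adjacent clusters, and the factor `e` by which the number of clusters decreases. -/
theorem exists_merge {r d e g : ℕ} (hn : 2 ≤ n) {Zs : Fin n → Finset (Fin n)}
    (hZs : IsHittingFamily e d g Zs) {O : SimpleGraph (Fin n) → Fin n → Finset (Fin n)}
    {ℓ : SimpleGraph (Fin n) → Fin n → Option (Fin n)}
    (h : Known (5 * Nat.clog 2 n) r (fun G v => (G.neighborSet v, O G v, ℓ G))) :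
    ∃ (O' : SimpleGraph (Fin n) → Fin n → Finset (Fin n))
      (T : SimpleGraph (Fin n) → Finset (Fin n)),
      Known (5 * Nat.clog 2 n) (r + 5)
        (fun G v => (G.neighborSet v, O' G v, mergeCenter G d (ℓ G) (T G))) ∧
      (∀ G v, O' G v = O G v ∪ mergeChoices G d (ℓ G) (T G) v) ∧
      ∀ G, e * #(centers (mergeCenter G d (ℓ G) (T G))) ≤ (2 + g) * #(centers (ℓ G)) := by
  classical
  have k₁ := h.comm (fits_node hn) fun x s b => contact s.1 s.2.2 x b
  obtain ⟨w, k₂, hwc, hw⟩ := k₁.hittingSet (fits_bool hn) (fits_fin hn (by omega) le_rfl) hZs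
    (fun b s => b ∈ centers s.1.2.2)
    (fun b s => b ∈ centers s.1.2.2 ∧ d ≤ #(adjClusters s.1.2.2 s.2))
    fun b s => adjSample d s.1.2.2 s.2
  have k₃ := k₂.comm (fits_node hn) fun b s x =>
    if ∃ a ∈ joined d s.1.1.2.2 s.1.2 (Zs s.2), delegate s.1.1.2.2 s.1.2 a = x then some b
    else none
  have k₄ := k₃.comm (fits_node hn) fun b s _ =>
    newCenter d s.1.1.1.2.2 s.1.1.2 (Zs s.1.2) b
  have k₅ := k₄.map fun x s => (s.1.1.1.1.1,
    s.1.1.1.1.2.1 ∪ ({y | ∃ b, (s.1.2 b).isSome ∧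
      contact s.1.1.1.1.1 s.1.1.1.1.2.2 x b = some y} : Finset (Fin n)),
    fun z => (s.1.1.1.1.2.2 z).bind s.2)
  have v₀ : Fin n := ⟨0, by omega⟩
  have hwT : ∀ G v, Zs (w G v) = Zs (w G v₀) := fun G v => by rw [hwc G v v₀]
  refine ⟨fun G v => O G v ∪ mergeChoices G d (ℓ G) (Zs (w G v₀)) v, fun G => Zs (w G v₀), ?_,
    fun _ _ => rfl, fun G => ?_⟩
  · convert k₅ using 3 with G v
    refine Prod.ext rfl (Prod.ext ?_ ?_)
    · simp only [hwT]
      congr 1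
      ext y
      simp only [mergeChoices, mem_filter, mem_univ, true_and]
      refine exists_congr fun b => and_congr_left fun _ => ?_
      split_ifs with hc
      · exact ⟨fun _ => rfl, fun _ => hc⟩
      · exact ⟨fun h => absurd h hc, fun h => by simp at h⟩
    · simp only [hwT]
      rfl
  · set T := Zs (w G v₀) with hT
    have hb := hw G v₀ (centers (ℓ G))
      ({b | b ∈ centers (ℓ G) ∧ d ≤ #(adjClusters (ℓ G) (contactsIn G (ℓ G) b))})
      (fun _ => Iff.rfl) (fun u => by simp only [mem_filter, mem_univ, true_and]; rfl)
      (fun u hu => (adjSample_spec (mem_filter.1 hu).2.2).2)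
    rw [← hT] at hb
    refine (Nat.mul_le_mul_left e ?_).trans (hb.trans ?_)
    · refine (card_le_card fun a ha => ?_).trans (card_union_le _ _)
      obtain ⟨v, hv⟩ := mem_centers.1 ha
      obtain ⟨b, hvb, hb'⟩ := Option.bind_eq_some_iff.1 hv
      unfold newCenter at hb'
      split_ifs at hb' with hlt
      have hb' := Option.some.inj hb'
      rw [mem_union]
      cases hh : host d (ℓ G) (contactsIn G (ℓ G) b) T with
      | some a' =>
        rw [hh, Option.getD_some] at hb'
        subst hb'
        have hs := host_spec hh
        exact Or.inl (mem_inter.2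
          ⟨adjClusters_subset ((adjSample_spec (not_lt.1 hlt)).1 hs.1), hs.2⟩)
      | none =>
        rw [hh, Option.getD_none] at hb'
        subst hb'
        refine Or.inr (mem_filter.2 ⟨mem_filter.2
          ⟨mem_univ _, mem_centers.2 ⟨v, hvb⟩, not_lt.1 hlt⟩, ?_⟩)
        rw [Finset.disjoint_left]
        intro z hz hz'
        unfold host at hh
        rw [dif_pos ⟨z, hz, hz'⟩] at hh
        cases hh
    · have : #({b | b ∈ centers (ℓ G) ∧ d ≤ #(adjClusters (ℓ G) (contactsIn G (ℓ G) b))} :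
          Finset (Fin n)) ≤ #(centers (ℓ G)) :=
        card_le_card fun b hb => (mem_filter.1 hb).2.1
      calc _ ≤ #(centers (ℓ G)) + (1 + g) * #(centers (ℓ G)) := by gcongr
        _ = _ := by ring

end CongestedClique

/-! ### Bounding the number of clusters and the stretch -/

namespace CongestedClique

open Finset SimpleGraph

variable {n : ℕ}

/-- A bounded number of steps of merging clusters. -/
theorem exists_merges {r d e g : ℕ} (hn : 2 ≤ n) (hd : 0 < d) (he : 0 < e)
    {Zs : Fin n → Finset (Fin n)}
    (hZs : IsHittingFamily e d g Zs) {O : SimpleGraph (Fin n) → Fin n → Finset (Fin n)}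
    {ℓ : SimpleGraph (Fin n) → Fin n → Option (Fin n)}
    (h : Known (5 * Nat.clog 2 n) r (fun G v => (G.neighborSet v, O G v, ℓ G))) (J : ℕ) :
    ∃ (O' : SimpleGraph (Fin n) → Fin n → Finset (Fin n))
      (ℓ' : SimpleGraph (Fin n) → Fin n → Option (Fin n)),
      Known (5 * Nat.clog 2 n) (r + 5 * J) (fun G v => (G.neighborSet v, O' G v, ℓ' G)) ∧
      ∀ G, (∀ v, O G v ⊆ O' G v) ∧ (∀ u, ∀ v ∈ O' G u, v ∈ O G u ∨ G.Adj u v) ∧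
        ∑ v, #(O' G v) ≤ ∑ v, #(O G v) + J * ((2 + g) ^ J * #(centers (ℓ G)) * d) ∧
        e ^ J * #(centers (ℓ' G)) ≤ (2 + g) ^ J * #(centers (ℓ G)) ∧
        ∀ (H : SimpleGraph (Fin n)) (R : ℕ), (∀ u, ∀ v ∈ O' G u, H.Adj u v) →
          (∀ v a, ℓ G v = some a → H.edist v a ≤ R) →
          (∀ v a, ℓ' G v = some a → H.edist v a ≤ (4 ^ J * (R + 1) : ℕ)) ∧
          ∀ u v, G.Adj u v → (ℓ G u).isSome → (ℓ G v).isSome →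
            H.edist u v ≤ (2 * (4 ^ J * (R + 1)) : ℕ) ∨ (ℓ' G u).isSome ∧ (ℓ' G v).isSome := by
  classical
  induction J with
  | zero =>
    refine ⟨O, ℓ, h, fun G => ⟨fun v => subset_rfl, fun u v hv => Or.inl hv, by simp, by simp,
      fun H R hH hR => ⟨fun v a hv => (hR v a hv).trans ?_, fun u v _ hu hv => Or.inr ⟨hu, hv⟩⟩⟩⟩
    exact_mod_cast (by omega : R ≤ 4 ^ 0 * (R + 1))
  | succ J ih =>
    obtain ⟨O₁, ℓ₁, k₁, hs⟩ := ih
    obtain ⟨O₂, T, k₂, hO₂, hc₂⟩ := exists_merge hn hZs k₁ (d := d)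
    refine ⟨O₂, _, k₂, fun G => ?_⟩
    obtain ⟨h1, h2, h3, h4, h5⟩ := hs G
    refine ⟨fun v => ?_, fun u v hv => ?_, ?_, ?_, fun H R hH hR => ?_⟩
    · rw [hO₂]
      exact (h1 v).trans subset_union_left
    · rw [hO₂, mem_union] at hv
      rcases hv with hv | hv
      · exact h2 u v hv
      · exact Or.inr (adj_of_mem_mergeChoices hv)
    · have hJ : #(centers (ℓ₁ G)) ≤ (2 + g) ^ J * #(centers (ℓ G)) :=
        (Nat.le_mul_of_pos_left _ (pow_pos he J)).trans h4
      have hg : (2 + g) ^ J ≤ (2 + g) ^ (J + 1) := Nat.pow_le_pow_right (by omega) (by omega)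
      calc ∑ v, #(O₂ G v) ≤ ∑ v, (#(O₁ G v) + #(mergeChoices G d (ℓ₁ G) (T G) v)) :=
            sum_le_sum fun v _ => by rw [hO₂]; exact card_union_le _ _
        _ = ∑ v, #(O₁ G v) + ∑ v, #(mergeChoices G d (ℓ₁ G) (T G) v) := sum_add_distrib
        _ ≤ ∑ v, #(O G v) + J * ((2 + g) ^ J * #(centers (ℓ G)) * d) +
              (2 + g) ^ J * #(centers (ℓ G)) * d := by
            refine add_le_add h3 ((sum_card_mergeChoices_le hd).trans ?_)
            exact Nat.mul_le_mul hJ (min_le_left _ _)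
        _ = ∑ v, #(O G v) + (J + 1) * ((2 + g) ^ J * #(centers (ℓ G)) * d) := by ring
        _ ≤ _ := by gcongr
    · calc _ = e ^ J * (e * #(centers (mergeCenter G d (ℓ₁ G) (T G)))) := by ring
        _ ≤ e ^ J * ((2 + g) * #(centers (ℓ₁ G))) := Nat.mul_le_mul_left _ (hc₂ G)
        _ = (2 + g) * (e ^ J * #(centers (ℓ₁ G))) := by ring
        _ ≤ (2 + g) * ((2 + g) ^ J * #(centers (ℓ G))) := Nat.mul_le_mul_left _ h4
        _ = _ := by ring
    · have hH₁ : ∀ u, ∀ v ∈ O₁ G u, H.Adj u v := fun u v hv =>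
        hH u v (by rw [hO₂]; exact mem_union_left _ hv)
      have hH₂ : ∀ u, ∀ v ∈ mergeChoices G d (ℓ₁ G) (T G) u, H.Adj u v := fun u v hv =>
        hH u v (by rw [hO₂]; exact mem_union_right _ hv)
      obtain ⟨h6, h7⟩ := h5 H R hH₁ hR
      have hpos : 0 < 4 ^ J * (R + 1) := by positivity
      have hpow : 4 ^ (J + 1) * (R + 1) = 4 * (4 ^ J * (R + 1)) := by ring
      rw [hpow]
      refine ⟨fun v a hv => (edist_mergeCenter_le hH₂ h6 hv).trans ?_, fun u v huv hu hv => ?_⟩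
      · exact_mod_cast (by omega)
      · rcases h7 u v huv hu hv with h8 | ⟨hu, hv⟩
        · left
          refine h8.trans ?_
          exact_mod_cast (by omega)
        · have hle : ((4 * (4 ^ J * (R + 1)) + 1 : ℕ) : ℕ∞) ≤
              (2 * (4 * (4 ^ J * (R + 1))) : ℕ) := by
            exact_mod_cast (by omega)
          rcases edist_le_or_isSome_mergeCenter hH₂ h6 huv hu hv with h8 | h8
          · exact Or.inl (h8.trans hle)
          · rcases edist_le_or_isSome_mergeCenter hH₂ h6 huv.symm hv hu with h9 | h9
            · rw [SimpleGraph.edist_comm] at h9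
              exact Or.inl (h9.trans hle)
            · exact Or.inr ⟨h8, h9⟩

/-- In one round the nodes turn their choices into the graph that they describe. -/
theorem Known.ofChoices {B r : ℕ} {O : SimpleGraph (Fin n) → Fin n → Finset (Fin n)}
    (hB : Fits B (Option (Fin n))) (h : Known B r O) :
    Known B (r + 1) (fun G v => (SimpleGraph.ofChoices (O G)).neighborSet v) := by
  have k := h.comm_map hB (fun u o v => if v ∈ o then some u else none)
    fun v o m => ({u | v ≠ u ∧ (u ∈ o ∨ (m u).isSome)} : Set (Fin n))
  convert k using 3 with G v
  ext u
  simp only [mem_neighborSet, SimpleGraph.ofChoices, fromRel_adj, Set.mem_ofPred_eq]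
  refine and_congr_right fun _ => or_congr_right ?_
  split_ifs with h <;> simp [h]

/-! ### The parameters -/

/-- The hitting families, for a power `y` of two. -/
theorem exists_hittingFamily_pow {j : ℕ} (hj : 0 < j) (h1 : (2 ^ j) ^ 26 ≤ n)
    (h2 : n < (2 * 2 ^ j) ^ 26) {a b d : ℕ} (hab : a + b = 4) (hba : b ≤ a) (hb : 2 * b ≤ d) :
    ∃ Zs : Fin n → Finset (Fin n), IsHittingFamily ((2 ^ j) ^ b) ((2 ^ j) ^ d) 13 Zs := by
  have hpos : 0 < 2 ^ j := by positivity
  have h4 : 4 * j ≠ 0 := by omega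
  have : Fact (Nat.Prime 2) := ⟨Nat.prime_two⟩
  have : Fintype (GaloisField 2 (4 * j)) := Fintype.ofFinite _
  have hq : Fintype.card (GaloisField 2 (4 * j)) = (2 ^ j) ^ 4 := by
    rw [← Nat.card_eq_fintype_card, GaloisField.card 2 _ h4, ← pow_mul, mul_comm]
  refine exists_hitting_family (GaloisField 2 (4 * j)) (t := (2 ^ j) ^ a)
    (by rw [hq, ← hab, pow_add]) (by positivity) (Nat.pow_le_pow_right hpos hba) ?_ ?_ ?_
  · rw [← pow_mul, mul_comm]
    exact Nat.pow_le_pow_right hpos hb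
  · rw [hq, ← pow_mul]
    exact (Nat.pow_le_pow_right hpos (by norm_num)).trans h1
  · rw [hq, ← pow_mul]
    calc n ≤ (2 * 2 ^ j) ^ 26 := h2.le
      _ ≤ (2 ^ j * 2 ^ j) ^ 26 := by
        gcongr
        exact Nat.le_self_pow hj.ne' 2
      _ = _ := by ring

theorem exists_known_spanner {k σ : ℕ} (hn : 2 ^ 26 ≤ n) (hk : 1 ≤ k) (hσ : n < σ ^ k) :
    ∃ O : SimpleGraph (Fin n) → Fin n → Finset (Fin n),
      Known (5 * Nat.clog 2 n) (4 * Nat.log 2 k + 73) O ∧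
      ∀ G, (∀ u, ∀ v ∈ O G u, G.Adj u v) ∧
        ∑ v, #(O G v) ≤ n * (k * σ + 4 * k) + (11 * 15 ^ 12 + 15 ^ 24 * 2 ^ 26) * n ∧
        ∀ u v, G.Adj u v → (SimpleGraph.ofChoices (O G)).edist u v ≤ (4 ^ 12 * 18 * k : ℕ) := by
  classical
  have hn2 : 2 ≤ n := le_trans (by norm_num) hn
  -- The powers of `y` below are chosen such that the clusters, at most `15 * n / y ^ 2` of them in
  -- the beginning and fewer by a factor of `y / 15` after each merging step, are `O(√n)` after 11
  -- steps.
  obtain ⟨j, hj, h1, h2⟩ : ∃ j, 0 < j ∧ (2 ^ j) ^ 26 ≤ n ∧ n < (2 * 2 ^ j) ^ 26 := by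
    refine ⟨Nat.log (2 ^ 26) n, Nat.log_pos (by norm_num) hn, ?_, ?_⟩
    · rw [← pow_mul, mul_comm, pow_mul]
      exact Nat.pow_log_le_self _ (by omega)
    · have := Nat.lt_pow_succ_log_self (by norm_num : 1 < 2 ^ 26) n
      rwa [mul_pow, ← pow_mul, mul_comm (Nat.log _ _), pow_mul, ← pow_succ']
  obtain ⟨Zs₁, hZ₁⟩ := exists_hittingFamily_pow hj h1 h2 (a := 2) (b := 2) (d := 4) rfl le_rfl
    le_rfl
  obtain ⟨Zs₂, hZ₂⟩ := exists_hittingFamily_pow hj h1 h2 (a := 3) (b := 1) (d := 2) rfl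
    (by norm_num) le_rfl
  have hy2 : 2 ≤ 2 ^ j := Nat.le_self_pow hj.ne' 2
  generalize 2 ^ j = y at *
  rw [pow_one] at hZ₂
  have hy : 0 < y := by omega
  have hM : (y ^ 8 + 1) * ((y ^ 8 + 1) * y ^ 8) ≤ n := by
    have : 1 ≤ y ^ 8 := Nat.one_le_pow _ _ hy
    calc _ ≤ (2 * y ^ 8) * ((2 * y ^ 8) * y ^ 8) := by gcongr <;> omega
      _ = 2 ^ 2 * y ^ 24 := by ring
      _ ≤ y ^ 2 * y ^ 24 := by gcongr
      _ = y ^ 26 := by ring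
      _ ≤ n := h1
  have hkL : k + 1 ≤ 2 ^ (Nat.log 2 k + 1) := Nat.lt_pow_succ_log_self (by norm_num) k
  have hkL' : 2 ^ (Nat.log 2 k) ≤ k := Nat.pow_log_le_self 2 (by omega)
  obtain ⟨O₁, ℓ₁, k₁, hs₁⟩ := exists_ball_clustering hn2 hM (by rw [← pow_mul]) hZ₁ hσ hkL
  obtain ⟨O₂, ℓ₂, k₂, hs₂⟩ := exists_merges hn2 (by positivity) hy hZ₂ k₁ 11
  -- With the threshold `n + 1`, the last step keeps an edge between any two adjacent clusters.
  have hZ₃ : IsHittingFamily 0 (n + 1) 0 Zs₂ := fun _ _ _ _ => ⟨⟨0, by omega⟩, by simp⟩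
  obtain ⟨O₃, T, k₃, hO₃, -⟩ := exists_merge hn2 hZ₃ k₂ (d := n + 1)
  refine ⟨O₃, (k₃.map fun _ x => x.2.1).mono (by omega), fun G => ?_⟩
  obtain ⟨a1, a2, a3, a4⟩ := hs₁ G
  obtain ⟨b1, b2, b3, b4, b5⟩ := hs₂ G
  refine ⟨fun u v hv => ?_, ?_, fun u v huv => ?_⟩
  · rw [hO₃, mem_union] at hv
    rcases hv with hv | hv
    · exact (b2 u v hv).elim (a1 u v) id
    · exact adj_of_mem_mergeChoices hv
  · set N₁ := #(centers (ℓ₁ G)) with hN₁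
    set N₂ := #(centers (ℓ₂ G)) with hN₂
    have c1 : ∑ v, #(O₁ G v) ≤ n * (k * σ + 4 * k) := by
      refine a2.trans ?_
      gcongr
      rw [pow_succ, pow_succ]
      omega
    have c2 : 11 * ((2 + 13) ^ 11 * N₁ * y ^ 2) ≤ 11 * 15 ^ 12 * n := by
      calc 11 * ((2 + 13) ^ 11 * N₁ * y ^ 2) = 11 * 15 ^ 11 * (y ^ 2 * N₁) := by ring
        _ ≤ 11 * 15 ^ 11 * ((2 + 13) * n) := by gcongr
        _ = _ := by ring
    have c3 : y ^ 13 * N₂ ≤ 15 ^ 12 * n := by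
      calc y ^ 13 * N₂ = y ^ 2 * (y ^ 11 * N₂) := by ring
        _ ≤ y ^ 2 * ((2 + 13) ^ 11 * N₁) := by gcongr
        _ = 15 ^ 11 * (y ^ 2 * N₁) := by ring
        _ ≤ 15 ^ 11 * ((2 + 13) * n) := by gcongr
        _ = _ := by ring
    have c4 : N₂ * N₂ ≤ 15 ^ 24 * 2 ^ 26 * n := by
      refine le_of_mul_le_mul_left ?_ (pow_pos hy 26)
      calc y ^ 26 * (N₂ * N₂) = (y ^ 13 * N₂) * (y ^ 13 * N₂) := by ring
        _ ≤ (15 ^ 12 * n) * (15 ^ 12 * n) := Nat.mul_le_mul c3 c3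
        _ = 15 ^ 24 * n * n := by ring
        _ ≤ 15 ^ 24 * n * (2 * y) ^ 26 := by gcongr
        _ = _ := by ring
    calc ∑ v, #(O₃ G v) ≤ ∑ v, (#(O₂ G v) + #(mergeChoices G (n + 1) (ℓ₂ G) (T G) v)) :=
          sum_le_sum fun v _ => by rw [hO₃]; exact card_union_le _ _
      _ = ∑ v, #(O₂ G v) + ∑ v, #(mergeChoices G (n + 1) (ℓ₂ G) (T G) v) := sum_add_distrib
      _ ≤ (n * (k * σ + 4 * k) + 11 * 15 ^ 12 * n) + 15 ^ 24 * 2 ^ 26 * n := by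
          refine add_le_add (b3.trans (add_le_add c1 c2)) ?_
          refine (sum_card_mergeChoices_le (Nat.succ_pos n)).trans (le_trans ?_ c4)
          exact Nat.mul_le_mul_left _ (min_le_right _ _)
      _ = _ := by ring
  · set H := SimpleGraph.ofChoices (O₃ G) with hH
    have hH₃ : ∀ u, ∀ v ∈ O₃ G u, H.Adj u v := fun u v hv => by
      refine (fromRel_adj _ _ _).2 ⟨?_, Or.inl hv⟩
      rw [hO₃, mem_union] at hv
      rcases hv with hv | hv
      · exact ((b2 u v hv).elim (a1 u v) id).ne
      · exact (adj_of_mem_mergeChoices hv).ne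
    have hH₂ : ∀ u, ∀ v ∈ O₂ G u, H.Adj u v := fun u v hv =>
      hH₃ u v (by rw [hO₃]; exact mem_union_left _ hv)
    obtain ⟨d1, d2⟩ := a4 H fun u v hv => hH₂ u v (b1 u hv)
    obtain ⟨d3, d4⟩ := b5 H _ hH₂ d1
    have hR : 4 ^ 11 * (2 ^ (Nat.log 2 k + 1 + 2) + 1) ≤ 4 ^ 11 * (9 * k) := by
      gcongr
      rw [pow_add, pow_add]
      omega
    have hR1 : 2 * (4 ^ 11 * (2 ^ (Nat.log 2 k + 1 + 2) + 1)) ≤ 4 ^ 12 * 18 * k :=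
      (Nat.mul_le_mul_left 2 hR).trans (by omega)
    have hR2 : 4 * (4 ^ 11 * (2 ^ (Nat.log 2 k + 1 + 2) + 1)) + 1 ≤ 4 ^ 12 * 18 * k :=
      (Nat.add_le_add_right (Nat.mul_le_mul_left 4 hR) 1).trans (by omega)
    rcases d2 u v huv with h | ⟨hu, hv⟩
    · refine h.trans ?_
      exact_mod_cast (by omega : 2 * k ≤ 4 ^ 12 * 18 * k)
    rcases d4 u v huv hu hv with h | ⟨hu, hv⟩
    · exact h.trans (Nat.cast_le.2 hR1)
    rcases edist_le_or_isSome_mergeCenter (T := T G) (d := n + 1)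
      (fun u v hv => hH₃ u v (by rw [hO₃]; exact mem_union_right _ hv)) d3 huv hu hv with h | h
    · exact h.trans (Nat.cast_le.2 hR2)
    · rw [mergeCenter_eq_none] at h
      · simp at h
      · have := card_le_univ (centers (ℓ₂ G))
        rw [Fintype.card_fin] at this
        omega

theorem exists_pow_gt {n k : ℕ} (hn : 1 ≤ n) (hk : 1 ≤ k) :
    ∃ σ : ℕ, n < σ ^ k ∧ (σ : ℝ) ≤ 2 * (n : ℝ) ^ (1 / (k : ℝ)) := by
  have h1 : (1 : ℝ) ≤ (n : ℝ) ^ (1 / (k : ℝ)) :=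
    Real.one_le_rpow (by exact_mod_cast hn) (by positivity)
  refine ⟨⌊(n : ℝ) ^ (1 / (k : ℝ))⌋₊ + 1, ?_, ?_⟩
  · have h2 := Nat.lt_floor_add_one ((n : ℝ) ^ (1 / (k : ℝ)))
    have h3 : ((n : ℝ) ^ (1 / (k : ℝ))) ^ k = n := by
      rw [one_div]
      exact Real.rpow_inv_natCast_pow (by positivity) (by omega)
    have h4 := pow_lt_pow_left₀ h2 (by positivity) (by omega : k ≠ 0)
    rw [h3] at h4
    exact_mod_cast h4
  · push_cast
    have := Nat.floor_le (by positivity : 0 ≤ (n : ℝ) ^ (1 / (k : ℝ)))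
    linarith

/-- The input graph itself is a spanner, available without communication. -/
theorem exists_trivial_algorithm (B n : ℕ) : ∃ A : Algorithm n B, A.rounds = 0 ∧
    ∀ G, A.Constructs G G ∧ G.edgeSet.ncard ≤ n ^ 2 := by
  classical
  obtain ⟨A, hA, h⟩ := Known.exists_algorithm (H := fun G => G)
    (Known.neighborSet (n := n) (B := B))
  refine ⟨A, hA, fun G => ⟨h G, ?_⟩⟩
  have h1 := SimpleGraph.card_edgeFinset_le_card_choose_two (G := G)
  rw [Fintype.card_fin] at h1
  rw [← SimpleGraph.coe_edgeFinset, Set.ncard_coe_finset]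
  exact h1.trans (Nat.choose_le_pow n 2)

end CongestedClique

open CongestedClique in
theorem theorem3 :
    ∃ (b s : ℕ) (c r : ℝ)
      (A : (n k : ℕ) → CongestedClique.Algorithm n (b * Nat.clog 2 n)),
      ∀ n k : ℕ, 1 ≤ k →
        ((A n k).rounds : ℝ) ≤ r * Real.log k ∧
        ∀ G : SimpleGraph (Fin n), ∃ H : SimpleGraph (Fin n),
          (A n k).Constructs G H ∧
          G.IsSpanner H (s * k) ∧
          (H.edgeSet.ncard : ℝ) ≤ c * k * (n : ℝ) ^ (1 + 1 / (k : ℝ)) := by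
  suffices ∀ n k : ℕ, ∃ A : Algorithm n (5 * Nat.clog 2 n), 1 ≤ k →
      (A.rounds : ℝ) ≤ 200 * Real.log k ∧
        ∀ G : SimpleGraph (Fin n), ∃ H : SimpleGraph (Fin n),
          A.Constructs G H ∧ G.IsSpanner H (4 ^ 12 * 18 * k) ∧
          (H.edgeSet.ncard : ℝ) ≤ 10 ^ 40 * k * (n : ℝ) ^ (1 + 1 / (k : ℝ)) by
    choose A hA using this
    exact ⟨5, 4 ^ 12 * 18, 10 ^ 40, 200, A, hA⟩
  intro n k
  by_cases hk : 1 ≤ k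
  swap
  · obtain ⟨A, -⟩ := exists_trivial_algorithm (5 * Nat.clog 2 n) n
    exact ⟨A, fun h => absurd h hk⟩
  have hlog : 0 ≤ Real.log k := Real.log_natCast_nonneg k
  by_cases htriv : k = 1 ∨ n < 2 ^ 26
  · obtain ⟨A, hA, h⟩ := exists_trivial_algorithm (5 * Nat.clog 2 n) n
    refine ⟨A, fun _ => ⟨by rw [hA]; simp only [Nat.cast_zero]; positivity, fun G =>
      ⟨G, (h G).1, ⟨le_rfl, fun u v => ?_⟩, ?_⟩⟩⟩
    · refine le_mul_of_one_le_left zero_le ?_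
      exact_mod_cast (by omega : 1 ≤ 4 ^ 12 * 18 * k)
    · have h1 : (G.edgeSet.ncard : ℝ) ≤ (n : ℝ) ^ 2 := by exact_mod_cast (h G).2
      refine h1.trans ?_
      have hk' : (1 : ℝ) ≤ k := by exact_mod_cast hk
      rcases htriv with rfl | hn
      · have : (n : ℝ) ^ (1 + 1 / ((1 : ℕ) : ℝ)) = (n : ℝ) ^ 2 := by
          rw [← Real.rpow_natCast]
          norm_num
        rw [this]
        have : 0 ≤ (n : ℝ) ^ 2 := by positivity
        norm_num
        linarith
      · rcases Nat.eq_zero_or_pos n with rfl | hn0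
        · simp
          positivity
        have hn0' : (1 : ℝ) ≤ n := by exact_mod_cast hn0
        have hn' : (n : ℝ) ≤ 2 ^ 26 := by exact_mod_cast hn.le
        calc (n : ℝ) ^ 2 = n * n := sq _
          _ ≤ (10 ^ 40 * k) * (n : ℝ) ^ (1 + 1 / (k : ℝ)) := by
            refine mul_le_mul (hn'.trans ?_) ?_ (by positivity) (by positivity)
            · nlinarith
            · exact Real.self_le_rpow_of_one_le hn0' (by simp)
  · push Not at htriv
    obtain ⟨hk1, hn⟩ := htriv
    have hn1 : 1 ≤ n := le_trans (by norm_num) hn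
    obtain ⟨σ, hσ, hσ'⟩ := exists_pow_gt hn1 hk
    obtain ⟨O, kO, hO⟩ := exists_known_spanner hn hk hσ
    obtain ⟨A, hA, hc⟩ := (kO.ofChoices (fits_node (le_trans (by norm_num) hn))).exists_algorithm
      (H := fun G => SimpleGraph.ofChoices (O G))
    refine ⟨A, fun _ => ⟨?_, fun G => ⟨_, hc G, ⟨?_, ?_⟩, ?_⟩⟩⟩
    · rw [hA]
      have h2 : (2 : ℝ) ≤ k := by exact_mod_cast (by omega : 2 ≤ k)
      have h3 : Real.log 2 ≤ Real.log k := Real.log_le_log (by norm_num) h2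
      have h4 : (Nat.log 2 k : ℝ) * Real.log 2 ≤ Real.log k := by
        rw [← Real.log_pow]
        refine Real.log_le_log (by positivity) ?_
        exact_mod_cast Nat.pow_log_le_self 2 (by omega)
      have h5 := Real.log_two_gt_d9
      push_cast
      have h6 : (Nat.log 2 k : ℝ) * 0.5 ≤ Nat.log 2 k * Real.log 2 := by gcongr; linarith
      linarith
    · exact SimpleGraph.ofChoices_le (hO G).1
    · exact SimpleGraph.edist_le_mul_edist (by omega) (hO G).2.2
    · have h1 : ((SimpleGraph.ofChoices (O G)).edgeSet.ncard : ℝ) ≤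
          n * (k * σ + 4 * k) + (11 * 15 ^ 12 + 15 ^ 24 * 2 ^ 26) * n := by
        exact_mod_cast (SimpleGraph.ncard_edgeSet_ofChoices_le _).trans (hO G).2.1
      refine h1.trans ?_
      have hn0 : (1 : ℝ) ≤ n := by exact_mod_cast hn1
      have hk' : (1 : ℝ) ≤ k := by exact_mod_cast hk
      rw [Real.rpow_add (by linarith), Real.rpow_one]
      set x := (n : ℝ) ^ (1 / (k : ℝ)) with hx
      have hx1 : 1 ≤ x := Real.one_le_rpow hn0 (by positivity)
      have hkx : (k : ℝ) ≤ k * x := le_mul_of_one_le_right (by linarith) hx1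
      have hkx1 : 1 ≤ k * x := hk'.trans hkx
      have hks : (k : ℝ) * σ ≤ 2 * (k * x) := by
        calc (k : ℝ) * σ ≤ k * (2 * x) := by gcongr
          _ = _ := by ring
      calc (n : ℝ) * (k * σ + 4 * k) + (11 * 15 ^ 12 + 15 ^ 24 * 2 ^ 26) * n
          = n * ((k * σ + 4 * k) + (11 * 15 ^ 12 + 15 ^ 24 * 2 ^ 26)) := by ring
        _ ≤ n * (10 ^ 40 * (k * x)) := by
          gcongr
          linarith
        _ = _ := by ring
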